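/- Let $\Omega\subset\mathbb R^2$ be a domain, i.e. a bounded connected open set with Lipschitz-continuous boundary, lying locally on one side of its boundary. Let $T>0$, $2.8\le p\le 5$, $p'=p/(p-1)$, $\alpha=\frac{3p-1}{2p}$ (so $1<\alpha<2$) and $\alpha'=\alpha/(\alpha-1)$. Let $\mu$ be a measurable function with $\mu_1\le\mu(x)\le\mu_2$ for all $x\in\overline\Omega$, where $\mu_1,\mu_2>0$ are constants, let $\tilde a\in W^{1,p}(0,T;\mathcal C^0(\overline\Omega))$, and let $u_0\in W_0^{1,p}(\Omega)$ with $u_0\ge 0$ a.e. in $\Omega$. Write $\{s\}^-=\max\{-s,0\}$, let $W_0^{1,p}(\Omega)$ carry the norm $\|v\|_{W_0^{1,p}(\Omega)}=\big(\|v\|_{L^p(\Omega)}^p+\|\nabla v\|_{L^p(\Omega)}^p\big)^{1/p}$, and let $W^{-1,p'}(\Omega)$ be its dual space with the dual norm; a function $f$ is identified with the functional $v\mapsto\int_\Omega fv\,dx$. The functions $|s|^{\alpha-2}s$ and $|s|^{(\alpha-2)/2}s$ are understood to be $0$ at $s=0$. For $\kappa>0$ and an integer $N\ge1$ put $\ell=T/N$.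 A semi-discrete solution for $(\kappa,N)$ is a family $u_{\kappa,\ell}^0,\dots,u_{\kappa,\ell}^N\in W_0^{1,p}(\Omega)$ with $u_{\kappa,\ell}^0=u_0$ such that, for every $0\le n\le N-1$, $$\frac{|u_{\kappa,\ell}^{n+1}|^{\alpha-2}u_{\kappa,\ell}^{n+1}-|u_{\kappa,\ell}^{n}|^{\alpha-2}u_{\kappa,\ell}^{n}}{\ell}-\nabla\cdot\left(\mu|\nabla u_{\kappa,\ell}^{n+1}|^{p-2}\nabla u_{\kappa,\ell}^{n+1}\right)-\frac{\{u_{\kappa,\ell}^{n+1}\}^-}{\kappa}=\frac1\ell\int_{n\ell}^{(n+1)\ell}\tilde a(t)\,dt\quad\text{in }W^{-1,p'}(\Omega).$$ Theorem. For every $C_1>0$ there is a constant $C>0$, independent of $\kappa$ and $N$ (it may depend on $\Omega,T,p,\mu,\tilde a,u_0,C_1$), such that for all $\kappa>0$, all integers $N\ge1$ and every semi-discrete solution for $(\kappa,N)$ that satisfies the stability condition $$\frac1\kappa\sum_{n=0}^{N-1}\int_\Omega\{u_{\kappa,\ell}^{n+1}\}^-\,(u_{\kappa,\ell}^{n+1}-u_{\kappa,\ell}^{n})\,dx\le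 C_1,\qquad\text{(SC1)}$$ the following estimates hold: $$\max_{0\le n\le N}\|u_{\kappa,\ell}^n\|_{L^\alpha(\Omega)}\le C,$$ $$\ell\sum_{n=0}^N\|u_{\kappa,\ell}^n\|_{W_0^{1,p}(\Omega)}^p\le C,$$ $$\ell\sum_{n=0}^{N-1}\left\|\frac{|u_{\kappa,\ell}^{n+1}|^{\frac{\alpha-2}{2}}u_{\kappa,\ell}^{n+1}-|u_{\kappa,\ell}^{n}|^{\frac{\alpha-2}{2}}u_{\kappa,\ell}^{n}}{\ell}\right\|_{L^2(\Omega)}^2\le C,$$ $$\max_{0\le n\le N}\left\||u_{\kappa,\ell}^n|^{\frac{\alpha-2}{2}}u_{\kappa,\ell}^n\right\|_{L^2(\Omega)}\le C,$$ $$\max_{0\le n\le N}\|u_{\kappa,\ell}^n\|_{W_0^{1,p}(\Omega)}\le C,$$ $$\max_{0\le n\le N-1}\left\|\frac{|u_{\kappa,\ell}^{n+1}|^{\alpha-2}u_{\kappa,\ell}^{n+1}-|u_{\kappa,\ell}^{n}|^{\alpha-2}u_{\kappa,\ell}^{n}}{\ell}\right\|_{W^{-1,p'}(\Omega)}\le C\left(1+\frac1\kappa\right),$$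 $$\max_{0\le n\le N}\left\||u_{\kappa,\ell}^n|^{\alpha-2}u_{\kappa,\ell}^n\right\|_{L^{\alpha'}(\Omega)}\le C.$$ -/

import Mathlib

open MeasureTheory Filter Topology
open scoped ENNReal ContDiff BoundedContinuousFunction

noncomputable section

namespace IceSheet

/-- The Euclidean plane. -/
abbrev Plane : Type := EuclideanSpace ℝ (Fin 2)

/-- A domain in the plane: a bounded, connected, open set that near each of its boundary points is,
in suitable orthonormal coordinates centred at the point, the set lying strictly above the graph of
a Lipschitz function (so that the set is locally on one side of its boundary). -/
def IsLipschitzDomain (Ω : Set Plane) : Prop :=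
  IsOpen Ω ∧ IsConnected Ω ∧ Bornology.IsBounded Ω ∧
    ∀ x₀ ∈ frontier Ω, ∃ (R : Plane ≃ₗᵢ[ℝ] Plane) (γ : ℝ → ℝ) (K : NNReal) (r : ℝ),
      0 < r ∧ LipschitzWith K γ ∧
        ∀ x ∈ Metric.ball x₀ r, x ∈ Ω ↔ γ (R (x - x₀) 0) < R (x - x₀) 1

/-- Smooth functions with compact support contained in `Ω`. -/
def IsTestFunction (Ω : Set Plane) (φ : Plane → ℝ) : Prop :=
  ContDiff ℝ ∞ φ ∧ HasCompactSupport φ ∧ tsupport φ ⊆ Ω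

/-- `G` is a weak (distributional) gradient of `u` in `Ω`. -/
def HasWeakGradient (Ω : Set Plane) (u : Plane → ℝ) (G : Plane → Plane) : Prop :=
  LocallyIntegrableOn u Ω ∧ LocallyIntegrableOn G Ω ∧
    ∀ φ : Plane → ℝ, IsTestFunction Ω φ →
      ∫ x in Ω, u x • gradient φ x = -∫ x in Ω, φ x • G x

open Classical in
/-- The weak gradient of `u` in `Ω` (a representative; it is zero if there is none). -/
def weakGradient (Ω : Set Plane) (u : Plane → ℝ) : Plane → Plane :=
  if h : ∃ G, HasWeakGradient Ω u G then h.choose else 0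

/-- `u` represents an element of the Sobolev space `W^{1,p}(Ω)`. -/
def MemW1 (Ω : Set Plane) (p : ℝ) (u : Plane → ℝ) : Prop :=
  MemLp u (ENNReal.ofReal p) (volume.restrict Ω) ∧
    ∃ G, HasWeakGradient Ω u G ∧ MemLp G (ENNReal.ofReal p) (volume.restrict Ω)

/-- The norm of `W^{1,p}(Ω)`, to be used on members of that space. -/
def w1Norm (Ω : Set Plane) (p : ℝ) (u : Plane → ℝ) : ℝ≥0∞ :=
  (eLpNorm u (ENNReal.ofReal p) (volume.restrict Ω) ^ p +
    eLpNorm (weakGradient Ω u) (ENNReal.ofReal p) (volume.restrict Ω) ^ p) ^ (1 / p)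

/-- `u` represents an element of `W_0^{1,p}(Ω)`, the closure of the test functions in
`W^{1,p}(Ω)`. -/
def MemW10 (Ω : Set Plane) (p : ℝ) (u : Plane → ℝ) : Prop :=
  MemW1 Ω p u ∧ ∃ φ : ℕ → Plane → ℝ, (∀ k, IsTestFunction Ω (φ k)) ∧
    Tendsto (fun k => w1Norm Ω p (fun x => u x - φ k x)) atTop (𝓝 0)

/-- The norm in `W^{-1,p'}(Ω)`, the dual of `W_0^{1,p}(Ω)`, of the functional
`v ↦ ∫_Ω f v`. -/
def dualNorm (Ω : Set Plane) (p : ℝ) (f : Plane → ℝ) : ℝ≥0∞ :=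
  ⨆ (v : Plane → ℝ) (_ : MemW10 Ω p v) (_ : w1Norm Ω p v ≤ 1), ‖∫ x in Ω, f x * v x‖ₑ

/-- `a` belongs to `W^{1,p}(0,T;X)`: it is in `L^p(0,T;X)` and has a weak derivative there. -/
def MemW1Time {X : Type*} [NormedAddCommGroup X] [NormedSpace ℝ X] (T p : ℝ) (a : ℝ → X) : Prop :=
  MemLp a (ENNReal.ofReal p) (volume.restrict (Set.Ioo 0 T)) ∧
    ∃ a' : ℝ → X, MemLp a' (ENNReal.ofReal p) (volume.restrict (Set.Ioo 0 T)) ∧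
      ∀ φ : ℝ → ℝ, ContDiff ℝ ∞ φ → HasCompactSupport φ → tsupport φ ⊆ Set.Ioo 0 T →
        ∫ t in Set.Ioo 0 T, deriv φ t • a t = -∫ t in Set.Ioo 0 T, φ t • a' t

open Classical in
/-- Extension by zero to the plane of a function on the closure of `Ω`. The bounded continuous
functions on the closure of a bounded `Ω` form the space `C^0` of that compact set, with the
maximum norm. -/
def extendZero {Ω : Set Plane} (f : closure Ω →ᵇ ℝ) (x : Plane) : ℝ :=
  if h : x ∈ closure Ω then f ⟨x, h⟩ else 0

/-- The negative part `{s}^- = (|s| - s)/2`. -/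
def negPart (s : ℝ) : ℝ := (|s| - s) / 2

/-- The odd power `|s|^q s`, which vanishes at zero. -/
def oddPow (q s : ℝ) : ℝ := |s| ^ q * s

/-- The exponent `α = (3p-1)/(2p)`. -/
def alpha (p : ℝ) : ℝ := (3 * p - 1) / (2 * p)

/-- The time step `ℓ = T/N`. -/
def step (T : ℝ) (N : ℕ) : ℝ := T / N

/-- `(u^n)_{0 ≤ n ≤ N}` solves the penalized semi-discrete scheme: all its terms lie in
`W_0^{1,p}(Ω)`, `u^0 = u₀`, and each step from `n` to `n + 1 ≤ N` satisfies, in `W^{-1,p'}(Ω)`, the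
equation whose weak form is displayed here; its right-hand side is the mean of `a` over the time
interval from `nℓ` to `(n+1)ℓ`. -/
def IsSemiDiscreteSolution (Ω : Set Plane) (p T : ℝ) (μ : Plane → ℝ) (a : ℝ → closure Ω →ᵇ ℝ)
    (u₀ : Plane → ℝ) (κ : ℝ) (N : ℕ) (u : ℕ → Plane → ℝ) : Prop :=
  u 0 =ᵐ[volume.restrict Ω] u₀ ∧ (∀ n ≤ N, MemW10 Ω p (u n)) ∧
    ∀ n < N, ∀ v : Plane → ℝ, MemW10 Ω p v →
      1 / step T N * (∫ x in Ω,
          (oddPow (alpha p - 2) (u (n + 1) x) - oddPow (alpha p - 2) (u n x)) * v x)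
        + (∫ x in Ω, μ x * (‖weakGradient Ω (u (n + 1)) x‖ ^ (p - 2) *
            inner ℝ (weakGradient Ω (u (n + 1)) x) (weakGradient Ω v x)))
        - 1 / κ * (∫ x in Ω, negPart (u (n + 1) x) * v x)
      = ∫ x in Ω, extendZero
          ((1 / step T N) • ∫ t in (n * step T N)..((n + 1) * step T N), a t) x * v x

end IceSheet

end

noncomputable section

namespace IceSheet

/-! ### Pointwise inequalities -/

/-! All the estimates come from one energy inequality, obtained by testing each time step with `u
(n+1) - u n`. Write `α = alpha p` and `ℓ = step T N`.

Each term on the left then has a good sign or telescopes. The time difference dominates `(α - 1) /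
ℓ` times the squared `L²` norm of the increment of `|u|^((α-2)/2) u` (`oddPow_sub_sq_le`). The
diffusion term dominates the increment of the energy `∫ μ ‖∇u‖^p / p`, by convexity
(`rpow_norm_sub_le_inner`). The penalty term dominates the increment of `∫ (u⁻)² / (2κ)`, again by
convexity (`negPart_mul_sub_le`). This penalty energy is zero at the start, because `u₀ ≥ 0`, and
nonnegative later, so it drops out of the summed inequality and `κ` disappears with it.

On the right stand the products of the time averages of the source with the increments of `u`.
Summation by parts moves the differences onto the averages. A function in `W^{1,p}(0,T;X)` is a
primitive of an integrable function, so its averages are bounded and of bounded variation uniformly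
in `N` (`MemW1Time.exists_bound_average`). The right side is therefore at most `3KY`, where `Y`
bounds the `L¹` norms of all iterates.

To close the argument (`exists_uniform_bound`), the inequality is stopped at the index where `∫
‖∇u‖^p` is largest. Young's and Poincaré's inequalities make `3KY` at most half of the energy there
plus a constant, so it can be absorbed. The remaining norms follow because lower powers are
dominated by `1 + |u|^p` on a bounded set, and the dual norm of the difference quotient is read off
the equation (`dualNorm_le`). -/

theorem abs_oddPow {q : ℝ} (hq : -1 < q) (s : ℝ) : |oddPow q s| = |s| ^ (q + 1) := by
  unfold oddPow
  rcases eq_or_ne s 0 with rfl | hs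
  · rw [mul_zero, abs_zero, Real.zero_rpow (by linarith)]
  · rw [abs_mul, Real.rpow_add_one (abs_ne_zero.2 hs), abs_of_nonneg (Real.rpow_nonneg (abs_nonneg s) q)]

theorem oddPow_neg (q s : ℝ) : oddPow q (-s) = -oddPow q s := by
  simp [oddPow]

theorem oddPow_of_nonneg {q : ℝ} (hq : -1 < q) {s : ℝ} (hs : 0 ≤ s) :
    oddPow q s = s ^ (q + 1) := by
  have h := abs_oddPow hq s
  have h0 : 0 ≤ oddPow q s := mul_nonneg (Real.rpow_nonneg (abs_nonneg s) q) hs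
  rwa [abs_of_nonneg h0, abs_of_nonneg hs] at h

theorem measurable_oddPow (q : ℝ) : Measurable (oddPow q) := by
  unfold oddPow; fun_prop

/-- Both sides are homogeneous of degree `α`, so with `r = s t` only `t ∈ [0, 1]` matters.
Bernoulli's inequality for the exponent `α - 1 ≤ 1` gives `1 - t^(α-1) ≥ (α-1)(1-t)`, while `t^(α/2)
≥ t` gives `1 - t^(α/2) ≤ 1 - t`. -/
theorem oddPow_sub_sq_le_of_nonneg_of_pos {α r s : ℝ} (h1 : 1 < α) (h2 : α ≤ 3 / 2) (hr : 0 ≤ r)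
    (hs : 0 < s) (hrs : r ≤ s) :
    (α - 1) * (oddPow ((α - 2) / 2) s - oddPow ((α - 2) / 2) r) ^ 2 ≤
      (oddPow (α - 2) s - oddPow (α - 2) r) * (s - r) := by
  rw [oddPow_of_nonneg (by linarith) hr, oddPow_of_nonneg (by linarith) hr,
    oddPow_of_nonneg (by linarith) hs.le, oddPow_of_nonneg (by linarith) hs.le]
  obtain ⟨t, rfl⟩ : ∃ t, r = s * t := ⟨r / s, by field_simp⟩
  have ht : 0 ≤ t := nonneg_of_mul_nonneg_right hr hs
  have ht1 : t ≤ 1 := by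
    by_contra! h
    nlinarith
  rw [Real.mul_rpow hs.le ht, Real.mul_rpow hs.le ht]
  have hss : (s ^ ((α - 2) / 2 + 1)) ^ 2 = s ^ (α - 2 + 1) * s := by
    rw [← Real.rpow_natCast, ← Real.rpow_mul hs.le, ← Real.rpow_add_one hs.ne']
    congr 1; push_cast; ring
  have hb : t ^ (α - 2 + 1) ≤ 1 + (α - 2 + 1) * (t - 1) := by
    have := rpow_one_add_le_one_add_mul_self (s := t - 1) (by linarith)
      (p := α - 2 + 1) (by linarith) (by linarith)
    simpa using this
  have ha : t ≤ t ^ ((α - 2) / 2 + 1) := by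
    rcases ht.eq_or_lt with rfl | ht0
    · exact Real.rpow_nonneg le_rfl _
    · simpa using Real.rpow_le_rpow_of_exponent_ge ht0 ht1 (show (α - 2) / 2 + 1 ≤ 1 by linarith)
  have ha1 : t ^ ((α - 2) / 2 + 1) ≤ 1 := Real.rpow_le_one ht ht1 (by linarith)
  have hsp : 0 ≤ s ^ (α - 2 + 1) * s := mul_nonneg (Real.rpow_nonneg hs.le _) hs.le
  have key : (α - 1) * (1 - t ^ ((α - 2) / 2 + 1)) ^ 2 ≤ (1 - t ^ (α - 2 + 1)) * (1 - t) := by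
    have e1 : (1 - t ^ ((α - 2) / 2 + 1)) ^ 2 ≤ (1 - t) ^ 2 :=
      pow_le_pow_left₀ (by linarith) (by linarith) 2
    have e2 : (α - 1) * (1 - t) ≤ 1 - t ^ (α - 2 + 1) := by linarith
    calc _ ≤ (α - 1) * (1 - t) ^ 2 := by gcongr
      _ = (α - 1) * (1 - t) * (1 - t) := by ring
      _ ≤ _ := by gcongr
  calc _ = (s ^ ((α - 2) / 2 + 1)) ^ 2 * ((α - 1) * (1 - t ^ ((α - 2) / 2 + 1)) ^ 2) := by ring
    _ ≤ s ^ (α - 2 + 1) * s * ((1 - t ^ (α - 2 + 1)) * (1 - t)) := by rw [hss]; gcongr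
    _ = _ := by ring

theorem oddPow_sub_sq_le_of_nonneg {α r s : ℝ} (h1 : 1 < α) (h2 : α ≤ 3 / 2) (hr : 0 ≤ r)
    (hs : 0 ≤ s) :
    (α - 1) * (oddPow ((α - 2) / 2) s - oddPow ((α - 2) / 2) r) ^ 2 ≤
      (oddPow (α - 2) s - oddPow (α - 2) r) * (s - r) := by
  rcases lt_trichotomy r s with h | rfl | h
  · exact oddPow_sub_sq_le_of_nonneg_of_pos h1 h2 hr (by linarith) h.le
  · simp
  · have := oddPow_sub_sq_le_of_nonneg_of_pos h1 h2 hs (by linarith) h.le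
    linarith

/-- For opposite signs the differences become sums. Since `α - 1 ≤ 1/2`, the bound `(a + b)² ≤ 2(a²
+ b²)` leaves `s^α + |r|^α`, and the cross terms on the right are nonnegative. -/
theorem oddPow_sub_sq_le_of_nonneg_of_nonpos {α r s : ℝ} (h1 : 1 < α) (h2 : α ≤ 3 / 2)
    (hr : r ≤ 0) (hs : 0 ≤ s) :
    (α - 1) * (oddPow ((α - 2) / 2) s - oddPow ((α - 2) / 2) r) ^ 2 ≤
      (oddPow (α - 2) s - oddPow (α - 2) r) * (s - r) := by
  obtain ⟨r, rfl⟩ : ∃ r', r = -r' := ⟨-r, by ring⟩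
  have hr : 0 ≤ r := by linarith
  rw [oddPow_neg, oddPow_neg, oddPow_of_nonneg (by linarith) hr, oddPow_of_nonneg (by linarith) hr,
    oddPow_of_nonneg (by linarith) hs, oddPow_of_nonneg (by linarith) hs]
  have hsq : ∀ x : ℝ, 0 ≤ x → (x ^ ((α - 2) / 2 + 1)) ^ 2 = x ^ (α - 2 + 1) * x := by
    intro x hx
    rcases hx.eq_or_lt with rfl | hx
    · rw [Real.zero_rpow (by linarith)]; simp
    rw [← Real.rpow_natCast, ← Real.rpow_mul hx.le, ← Real.rpow_add_one hx.ne']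
    congr 1; push_cast; ring
  have h3 := hsq r hr
  have h4 := hsq s hs
  have h5 := mul_nonneg (Real.rpow_nonneg hr (α - 2 + 1)) hs
  have h6 := mul_nonneg (Real.rpow_nonneg hs (α - 2 + 1)) hr
  calc _ ≤ (1 / 2) * (s ^ ((α - 2) / 2 + 1) - -r ^ ((α - 2) / 2 + 1)) ^ 2 := by
        gcongr; linarith
    _ ≤ (s ^ ((α - 2) / 2 + 1)) ^ 2 + (r ^ ((α - 2) / 2 + 1)) ^ 2 := by
        nlinarith [sq_nonneg (s ^ ((α - 2) / 2 + 1) - r ^ ((α - 2) / 2 + 1))]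
    _ ≤ _ := by rw [h3, h4]; linarith

/-- Strong monotonicity of `s ↦ |s|^{α-2} s`, measured through `s ↦ |s|^{(α-2)/2} s`. -/
theorem oddPow_sub_sq_le {α : ℝ} (h1 : 1 < α) (h2 : α ≤ 3 / 2) (r s : ℝ) :
    (α - 1) * (oddPow ((α - 2) / 2) s - oddPow ((α - 2) / 2) r) ^ 2 ≤
      (oddPow (α - 2) s - oddPow (α - 2) r) * (s - r) := by
  rcases le_total 0 s with hs | hs <;> rcases le_total 0 r with hr | hr
  · exact oddPow_sub_sq_le_of_nonneg h1 h2 hr hs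
  · exact oddPow_sub_sq_le_of_nonneg_of_nonpos h1 h2 hr hs
  · have := oddPow_sub_sq_le_of_nonneg_of_nonpos h1 h2 hs hr
    linarith
  · have := oddPow_sub_sq_le_of_nonneg h1 h2 (r := -r) (s := -s) (by linarith) (by linarith)
    simp only [oddPow_neg] at this
    linarith

/-- Convexity of `ξ ↦ ‖ξ‖^p / p`. -/
theorem rpow_norm_sub_le_inner {E : Type*} [NormedAddCommGroup E] [InnerProductSpace ℝ E] {p : ℝ}
    (hp : 2 ≤ p) (ξ η : E) :
    (‖ξ‖ ^ p - ‖η‖ ^ p) / p ≤ ‖ξ‖ ^ (p - 2) * inner ℝ ξ (ξ - η) := by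
  have hpp : 0 < p := by linarith
  rcases eq_or_ne ξ 0 with rfl | hξ
  · rw [inner_zero_left, norm_zero, Real.zero_rpow hpp.ne', mul_zero, zero_sub, neg_div]
    have : 0 ≤ ‖η‖ ^ p / p := by positivity
    linarith
  have hx : 0 < ‖ξ‖ := norm_pos_iff.2 hξ
  -- Young's inequality with weights `1 - 1/p` and `1/p` for the cross term left by Cauchy–Schwarz.
  have hy : ‖ξ‖ ^ (p - 1) * ‖η‖ ≤ (1 - 1 / p) * ‖ξ‖ ^ p + 1 / p * ‖η‖ ^ p := by
    have := Real.geom_mean_le_arith_mean2_weighted (w₁ := 1 - 1 / p) (w₂ := 1 / p)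
      (p₁ := ‖ξ‖ ^ p) (p₂ := ‖η‖ ^ p)
      (by rw [sub_nonneg, div_le_one hpp]; linarith) (by positivity) (by positivity) (by positivity)
      (by ring)
    rw [← Real.rpow_mul (norm_nonneg _), ← Real.rpow_mul (norm_nonneg _)] at this
    rwa [show p * (1 - 1 / p) = p - 1 by field_simp, show p * (1 / p) = 1 by field_simp,
      Real.rpow_one] at this
  have h1 : ‖ξ‖ ^ (p - 2) * ‖ξ‖ ^ 2 = ‖ξ‖ ^ p := by
    rw [← Real.rpow_natCast, ← Real.rpow_add hx]; congr 1; push_cast; ring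
  have h2 : ‖ξ‖ ^ (p - 2) * (‖ξ‖ * ‖η‖) = ‖ξ‖ ^ (p - 1) * ‖η‖ := by
    rw [← mul_assoc, ← Real.rpow_add_one hx.ne']; congr 2; ring
  have h3 : ‖ξ‖ ^ (p - 2) * inner ℝ ξ η ≤ ‖ξ‖ ^ (p - 2) * (‖ξ‖ * ‖η‖) := by
    gcongr; exact real_inner_le_norm ξ η
  rw [inner_sub_right, real_inner_self_eq_norm_sq, mul_sub, h1]
  have : (‖ξ‖ ^ p - ‖η‖ ^ p) / p = 1 / p * ‖ξ‖ ^ p - 1 / p * ‖η‖ ^ p := by ring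
  linarith

theorem negPart_nonneg (s : ℝ) : 0 ≤ negPart s := by
  unfold negPart; linarith [le_abs_self s]

theorem negPart_le_abs (s : ℝ) : negPart s ≤ |s| := by
  unfold negPart; linarith [neg_abs_le s]

theorem negPart_of_nonneg {s : ℝ} (hs : 0 ≤ s) : negPart s = 0 := by
  unfold negPart; rw [abs_of_nonneg hs]; ring

theorem measurable_negPart : Measurable negPart := by
  unfold negPart; fun_prop

/-- The function `s ↦ (s⁻)²/2` is convex with derivative `-s⁻`; this is its tangent line inequality
at `s`. It makes the penalty term telescope. -/
theorem negPart_mul_sub_le (s r : ℝ) :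
    negPart s * (s - r) ≤ negPart r ^ 2 / 2 - negPart s ^ 2 / 2 := by
  unfold negPart
  rcases abs_cases s with ⟨h, _⟩ | ⟨h, _⟩ <;> rcases abs_cases r with ⟨h', _⟩ | ⟨h', _⟩ <;>
    rw [h, h'] <;> nlinarith [sq_nonneg (s - r), sq_nonneg r, sq_nonneg s]

/-! ### Comparison of powers and forms of Young's inequality -/

theorem rpow_le_one_add_rpow {s q p : ℝ} (hs : 0 ≤ s) (hq : 0 ≤ q) (hqp : q ≤ p) :
    s ^ q ≤ 1 + s ^ p := by
  rcases le_total s 1 with h | h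
  · linarith [Real.rpow_le_one hs h hq, Real.rpow_nonneg hs p]
  · linarith [Real.rpow_le_rpow_of_exponent_le h hqp]

/-- Replacing the smaller of the two numbers by the larger bounds the product by a single pure
power. -/
theorem rpow_mul_le_rpow_add_rpow {s t q : ℝ} (hs : 0 ≤ s) (ht : 0 ≤ t) (hq : 0 ≤ q) :
    s ^ q * t ≤ s ^ (q + 1) + t ^ (q + 1) := by
  have key : ∀ m : ℝ, 0 ≤ m → m ^ q * m = m ^ (q + 1) := by
    intro m hm
    rw [Real.rpow_add_one' hm (by linarith)]
  rcases le_total s t with h | h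
  · calc s ^ q * t ≤ t ^ q * t := by gcongr
      _ = t ^ (q + 1) := key t ht
      _ ≤ _ := by linarith [Real.rpow_nonneg hs (q + 1)]
  · calc s ^ q * t ≤ s ^ q * s := by gcongr
      _ = s ^ (q + 1) := key s hs
      _ ≤ _ := by linarith [Real.rpow_nonneg ht (q + 1)]

theorem rpow_mul_le_one_add {s t q p : ℝ} (hs : 0 ≤ s) (ht : 0 ≤ t) (hq : 0 ≤ q)
    (hqp : q + 1 ≤ p) : s ^ q * t ≤ 2 + s ^ p + t ^ p := by
  have h1 := rpow_mul_le_rpow_add_rpow hs ht hq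
  have h2 := rpow_le_one_add_rpow hs (by linarith : 0 ≤ q + 1) hqp
  have h3 := rpow_le_one_add_rpow ht (by linarith : 0 ≤ q + 1) hqp
  linarith

/-- A form of Young's inequality. -/
theorem le_mul_rpow_add {s p ε : ℝ} (hs : 0 ≤ s) (hp : 1 < p) (hε : 0 < ε) :
    s ≤ ε * s ^ p + (1 / ε) ^ (1 / (p - 1)) := by
  have hp1 : 0 < p - 1 := by linarith
  have h0 : 0 < (1 / ε) ^ (1 / (p - 1)) := by positivity
  have hsp := Real.rpow_nonneg hs p
  -- The threshold is the point where `ε s^(p-1) = 1`; beyond it `ε s^p` alone dominates `s`.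
  rcases le_total s ((1 / ε) ^ (1 / (p - 1))) with h | h
  · have := mul_nonneg hε.le hsp
    linarith
  · have h1 : 1 / ε ≤ s ^ (p - 1) := by
      calc 1 / ε = ((1 / ε) ^ (1 / (p - 1))) ^ (p - 1) := by
            rw [← Real.rpow_mul (by positivity), one_div_mul_cancel hp1.ne', Real.rpow_one]
        _ ≤ _ := by gcongr
    have h2 : s ^ p = s ^ (p - 1) * s := by
      rw [← Real.rpow_add_one' hs (by linarith)]; congr 1; ring
    have h3 : 1 ≤ ε * s ^ (p - 1) := by
      calc 1 = ε * (1 / ε) := by field_simp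
        _ ≤ _ := by gcongr
    have h4 : s ≤ ε * s ^ (p - 1) * s := by nlinarith
    rw [h2, ← mul_assoc]; linarith

theorem one_lt_alpha {p : ℝ} (hp : 2.8 ≤ p) : 1 < alpha p := by
  unfold alpha; rw [lt_div_iff₀ (by linarith)]; linarith

/-- Indeed `α = 3/2 - 1/(2p)`. -/
theorem alpha_le {p : ℝ} (hp : 2.8 ≤ p) : alpha p ≤ 3 / 2 := by
  unfold alpha; rw [div_le_iff₀ (by linarith)]; linarith

/-! ### Sobolev functions -/

theorem IsTestFunction.continuous_gradient {Ω : Set Plane} {φ : Plane → ℝ}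
    (hφ : IsTestFunction Ω φ) : Continuous (gradient φ) := by
  have : Continuous (fderiv ℝ φ) := hφ.1.continuous_fderiv (by simp)
  exact (InnerProductSpace.toDual ℝ Plane).symm.continuous.comp this

theorem tsupport_gradient_subset (φ : Plane → ℝ) : tsupport (gradient φ) ⊆ tsupport φ := by
  refine closure_minimal (fun x hx => ?_) (isClosed_tsupport φ)
  refine support_fderiv_subset ℝ (f := φ) fun h => hx ?_
  simp [gradient, h]

theorem gradient_eq_zero_of_notMem {Ω : Set Plane} {φ : Plane → ℝ} (hφ : IsTestFunction Ω φ)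
    {x : Plane} (hx : x ∉ Ω) : gradient φ x = 0 :=
  image_eq_zero_of_notMem_tsupport fun h => hx (hφ.2.2 (tsupport_gradient_subset φ h))

theorem eq_zero_of_notMem {Ω : Set Plane} {φ : Plane → ℝ} (hφ : IsTestFunction Ω φ)
    {x : Plane} (hx : x ∉ Ω) : φ x = 0 :=
  image_eq_zero_of_notMem_tsupport fun h => hx (hφ.2.2 h)

theorem hasCompactSupport_gradient {Ω : Set Plane} {φ : Plane → ℝ} (hφ : IsTestFunction Ω φ) :
    HasCompactSupport (gradient φ) :=
  hφ.2.1.of_isClosed_subset (isClosed_tsupport _) (tsupport_gradient_subset φ)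

/-- The product of a continuous function with compact support in `Ω` and a locally integrable
function is integrable. -/
theorem integrableOn_smul_of_hasCompactSupport {E : Type*} [NormedAddCommGroup E] [NormedSpace ℝ E]
    {Ω : Set Plane} {φ : Plane → ℝ} {f : Plane → E} (hc : Continuous φ)
    (hs : HasCompactSupport φ) (hsub : tsupport φ ⊆ Ω) (hf : LocallyIntegrableOn f Ω) :
    IntegrableOn (fun x => φ x • f x) Ω := by
  have h1 : IntegrableOn (fun x => φ x • f x) (tsupport φ) :=
    (hf.integrableOn_compact_subset hsub hs).continuousOn_smul hc.continuousOn hs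
  have h2 : Integrable (fun x => φ x • f x) := by
    rw [← integrableOn_iff_integrable_of_support_subset (s := tsupport φ)]
    · exact h1
    · intro x hx
      refine subset_tsupport φ fun h => hx ?_
      simp [h]
  exact h2.integrableOn

theorem integrableOn_smul_of_hasCompactSupport_right {E : Type*} [NormedAddCommGroup E]
    [NormedSpace ℝ E] {Ω : Set Plane} {g : Plane → E} {f : Plane → ℝ} (hc : Continuous g)
    (hs : HasCompactSupport g) (hsub : tsupport g ⊆ Ω) (hf : LocallyIntegrableOn f Ω) :
    IntegrableOn (fun x => f x • g x) Ω := by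
  have h1 : IntegrableOn (fun x => f x • g x) (tsupport g) :=
    (hf.integrableOn_compact_subset hsub hs).smul_continuousOn hc.continuousOn hs
  have h2 : Integrable (fun x => f x • g x) := by
    rw [← integrableOn_iff_integrable_of_support_subset (s := tsupport g)]
    · exact h1
    · intro x hx
      refine subset_tsupport g fun h => hx ?_
      simp [h]
  exact h2.integrableOn

theorem HasWeakGradient.sub {Ω : Set Plane} {u v : Plane → ℝ} {G H : Plane → Plane}
    (hu : HasWeakGradient Ω u G) (hv : HasWeakGradient Ω v H) :
    HasWeakGradient Ω (fun x => u x - v x) (fun x => G x - H x) := by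
  refine ⟨hu.1.sub hv.1, hu.2.1.sub hv.2.1, fun φ hφ => ?_⟩
  have hg := tsupport_gradient_subset φ |>.trans hφ.2.2
  simp only [sub_smul, smul_sub]
  rw [integral_sub, integral_sub, hu.2.2 φ hφ, hv.2.2 φ hφ]
  · abel
  · exact integrableOn_smul_of_hasCompactSupport hφ.1.continuous hφ.2.1 hφ.2.2 hu.2.1
  · exact integrableOn_smul_of_hasCompactSupport hφ.1.continuous hφ.2.1 hφ.2.2 hv.2.1
  · exact integrableOn_smul_of_hasCompactSupport_right hφ.continuous_gradient
      (hasCompactSupport_gradient hφ) hg hu.1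
  · exact integrableOn_smul_of_hasCompactSupport_right hφ.continuous_gradient
      (hasCompactSupport_gradient hφ) hg hv.1

/-- Uniqueness of weak gradients. -/
theorem HasWeakGradient.ae_eq {Ω : Set Plane} (hΩ : IsOpen Ω) {u v : Plane → ℝ}
    {G H : Plane → Plane} (hu : HasWeakGradient Ω u G) (hv : HasWeakGradient Ω v H)
    (huv : u =ᵐ[volume.restrict Ω] v) : G =ᵐ[volume.restrict Ω] H := by
  have key := hΩ.ae_eq_zero_of_integral_contDiff_smul_eq_zero (μ := volume)
    (hu.2.1.sub hv.2.1) ?_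
  · rw [EventuallyEq, ae_restrict_iff' hΩ.measurableSet]
    filter_upwards [key] with x hx hxΩ
    exact sub_eq_zero.1 (hx hxΩ)
  intro φ h1 h2 h3
  have hφ : IsTestFunction Ω φ := ⟨h1, h2, h3⟩
  rw [← setIntegral_eq_integral_of_forall_compl_eq_zero (s := Ω)
    (fun x hx => by rw [eq_zero_of_notMem hφ hx, zero_smul])]
  simp only [Pi.sub_apply, smul_sub]
  rw [integral_sub, sub_eq_zero, ← neg_inj, ← hu.2.2 φ hφ, ← hv.2.2 φ hφ]
  · refine integral_congr_ae ?_
    filter_upwards [huv] with x hx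
    rw [hx]
  · exact integrableOn_smul_of_hasCompactSupport hφ.1.continuous hφ.2.1 hφ.2.2 hu.2.1
  · exact integrableOn_smul_of_hasCompactSupport hφ.1.continuous hφ.2.1 hφ.2.2 hv.2.1

theorem HasWeakGradient.weakGradient {Ω : Set Plane} {u : Plane → ℝ} {G : Plane → Plane}
    (hu : HasWeakGradient Ω u G) : HasWeakGradient Ω u (weakGradient Ω u) := by
  have h : ∃ G, HasWeakGradient Ω u G := ⟨G, hu⟩
  rw [IceSheet.weakGradient, dif_pos h]
  exact h.choose_spec

theorem HasWeakGradient.weakGradient_ae_eq {Ω : Set Plane} (hΩ : IsOpen Ω) {u : Plane → ℝ}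
    {G : Plane → Plane} (hu : HasWeakGradient Ω u G) :
    IceSheet.weakGradient Ω u =ᵐ[volume.restrict Ω] G :=
  hu.weakGradient.ae_eq hΩ hu (ae_eq_refl _)

/-- Pairing with a fixed vector reduces the identity to integration by parts for a directional
derivative. -/
theorem IsTestFunction.hasWeakGradient {Ω : Set Plane} {φ : Plane → ℝ}
    (hφ : IsTestFunction Ω φ) : HasWeakGradient Ω φ (gradient φ) := by
  refine ⟨(hφ.1.continuous.locallyIntegrable).locallyIntegrableOn Ω,
    (hφ.continuous_gradient.locallyIntegrable).locallyIntegrableOn Ω, fun ψ hψ => ?_⟩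
  rw [setIntegral_eq_integral_of_forall_compl_eq_zero
      (fun x hx => by rw [eq_zero_of_notMem hφ hx, zero_smul]),
    setIntegral_eq_integral_of_forall_compl_eq_zero
      (fun x hx => by rw [eq_zero_of_notMem hψ hx, zero_smul])]
  have i1 : Integrable (fun x => φ x • gradient ψ x) :=
    (hφ.1.continuous.smul hψ.continuous_gradient).integrable_of_hasCompactSupport
      hφ.2.1.smul_right
  have i2 : Integrable (fun x => ψ x • gradient φ x) :=
    (hψ.1.continuous.smul hφ.continuous_gradient).integrable_of_hasCompactSupport
      hψ.2.1.smul_right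
  refine ext_inner_left ℝ fun v => ?_
  rw [inner_neg_right, ← integral_inner i1, ← integral_inner i2]
  have e : ∀ (f : Plane → ℝ) (x : Plane), inner ℝ v (gradient f x) = fderiv ℝ f x v := by
    intro f x
    rw [real_inner_comm, ← InnerProductSpace.toDual_apply_apply (𝕜 := ℝ), toDual_gradient]
  simp only [inner_smul_right, e]
  have cφ : Continuous (fun x => fderiv ℝ φ x v) :=
    (hφ.1.continuous_fderiv (by simp)).clm_apply continuous_const
  have cψ : Continuous (fun x => fderiv ℝ ψ x v) :=
    (hψ.1.continuous_fderiv (by simp)).clm_apply continuous_const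
  rw [integral_mul_fderiv_eq_neg_fderiv_mul_of_integrable]
  · congr 1
    refine integral_congr_ae (ae_of_all _ fun x => ?_)
    exact mul_comm _ _
  · exact (cφ.mul hψ.1.continuous).integrable_of_hasCompactSupport hψ.2.1.mul_left
  · exact (hφ.1.continuous.mul cψ).integrable_of_hasCompactSupport hφ.2.1.mul_right
  · exact (hφ.1.continuous.mul hψ.1.continuous).integrable_of_hasCompactSupport hφ.2.1.mul_right
  · exact fun x _ => hφ.1.differentiable (by simp) x
  · exact fun x _ => hψ.1.differentiable (by simp) x

theorem norm_gradient (φ : Plane → ℝ) (x : Plane) : ‖gradient φ x‖ = ‖fderiv ℝ φ x‖ := by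
  rw [← toDual_gradient, LinearIsometryEquiv.norm_map]

theorem IsTestFunction.memLp {Ω : Set Plane} {φ : Plane → ℝ} (hφ : IsTestFunction Ω φ)
    (q : ℝ≥0∞) : MemLp φ q (volume.restrict Ω) :=
  (hφ.1.continuous.memLp_of_hasCompactSupport hφ.2.1).restrict Ω

theorem IsTestFunction.memLp_gradient {Ω : Set Plane} {φ : Plane → ℝ} (hφ : IsTestFunction Ω φ)
    (q : ℝ≥0∞) : MemLp (gradient φ) q (volume.restrict Ω) :=
  (hφ.continuous_gradient.memLp_of_hasCompactSupport (hasCompactSupport_gradient hφ)).restrict Ω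

theorem MemW1.memLp_weakGradient {Ω : Set Plane} (hΩ : IsOpen Ω) {p : ℝ} {u : Plane → ℝ}
    (hu : MemW1 Ω p u) : MemLp (weakGradient Ω u) (ENNReal.ofReal p) (volume.restrict Ω) := by
  obtain ⟨-, G, hG, hGp⟩ := hu
  exact hGp.ae_eq (hG.weakGradient_ae_eq hΩ).symm

theorem MemW1.hasWeakGradient {Ω : Set Plane} {p : ℝ} {u : Plane → ℝ}
    (hu : MemW1 Ω p u) : HasWeakGradient Ω u (weakGradient Ω u) := by
  obtain ⟨-, G, hG, -⟩ := hu
  exact hG.weakGradient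

theorem MemW1.sub {Ω : Set Plane} (hΩ : IsOpen Ω) {p : ℝ} {u v : Plane → ℝ}
    (hu : MemW1 Ω p u) (hv : MemW1 Ω p v) : MemW1 Ω p (fun x => u x - v x) :=
  ⟨hu.1.sub hv.1, _, hu.hasWeakGradient.sub hv.hasWeakGradient,
    (hu.memLp_weakGradient hΩ).sub (hv.memLp_weakGradient hΩ)⟩

theorem MemW1.weakGradient_sub {Ω : Set Plane} (hΩ : IsOpen Ω) {p : ℝ} {u v : Plane → ℝ}
    (hu : MemW1 Ω p u) (hv : MemW1 Ω p v) :
    weakGradient Ω (fun x => u x - v x) =ᵐ[volume.restrict Ω]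
      fun x => weakGradient Ω u x - weakGradient Ω v x :=
  (hu.hasWeakGradient.sub hv.hasWeakGradient).weakGradient_ae_eq hΩ

theorem IsTestFunction.memW1 {Ω : Set Plane} {φ : Plane → ℝ} (hφ : IsTestFunction Ω φ) (p : ℝ) :
    MemW1 Ω p φ :=
  ⟨hφ.memLp _, _, hφ.hasWeakGradient, hφ.memLp_gradient _⟩

theorem eLpNorm_le_w1Norm (Ω : Set Plane) {p : ℝ} (hp : 0 < p) (u : Plane → ℝ) :
    eLpNorm u (ENNReal.ofReal p) (volume.restrict Ω) ≤ w1Norm Ω p u := by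
  unfold w1Norm
  rw [one_div, ENNReal.le_rpow_inv_iff hp]
  exact le_self_add

theorem eLpNorm_weakGradient_le_w1Norm (Ω : Set Plane) {p : ℝ} (hp : 0 < p) (u : Plane → ℝ) :
    eLpNorm (weakGradient Ω u) (ENNReal.ofReal p) (volume.restrict Ω) ≤ w1Norm Ω p u := by
  unfold w1Norm
  rw [one_div, ENNReal.le_rpow_inv_iff hp]
  exact le_add_self

theorem tendsto_w1Norm_zero {Ω : Set Plane} {p : ℝ} (hp : 0 < p) {w : ℕ → Plane → ℝ}
    (h1 : Tendsto (fun k => eLpNorm (w k) (ENNReal.ofReal p) (volume.restrict Ω)) atTop (𝓝 0))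
    (h2 : Tendsto (fun k => eLpNorm (weakGradient Ω (w k)) (ENNReal.ofReal p)
      (volume.restrict Ω)) atTop (𝓝 0)) :
    Tendsto (fun k => w1Norm Ω p (w k)) atTop (𝓝 0) := by
  have h3 := (((h1.ennrpow_const p).add (h2.ennrpow_const p)).ennrpow_const (1 / p))
  rwa [ENNReal.zero_rpow_of_pos hp, add_zero, ENNReal.zero_rpow_of_pos (by positivity)] at h3

theorem MemW10.sub {Ω : Set Plane} (hΩ : IsOpen Ω) {p : ℝ} (hp : 1 ≤ p) {u v : Plane → ℝ}
    (hu : MemW10 Ω p u) (hv : MemW10 Ω p v) : MemW10 Ω p (fun x => u x - v x) := by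
  have hp0 : 0 < p := by linarith
  have hp1 : 1 ≤ ENNReal.ofReal p := by simpa using hp
  obtain ⟨hu1, φ, hφ, hφl⟩ := hu
  obtain ⟨hv1, ψ, hψ, hψl⟩ := hv
  refine ⟨hu1.sub hΩ hv1, fun k x => φ k x - ψ k x, fun k => ⟨(hφ k).1.sub (hψ k).1,
    (hφ k).2.1.sub (hψ k).2.1,
    (tsupport_sub _ _).trans (Set.union_subset (hφ k).2.2 (hψ k).2.2)⟩, ?_⟩
  have hsum := hφl.add hψl
  rw [add_zero] at hsum
  have mφ := fun k => hu1.sub hΩ ((hφ k).memW1 p)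
  have mψ := fun k => hv1.sub hΩ ((hψ k).memW1 p)
  have e : ∀ k, (fun x => u x - v x - (φ k x - ψ k x)) =
      fun x => (u x - φ k x) - (v x - ψ k x) := fun k => by ext x; ring
  simp only [e]
  refine tendsto_w1Norm_zero hp0 ?_ ?_
  · refine tendsto_of_tendsto_of_tendsto_of_le_of_le tendsto_const_nhds hsum
      (fun k => zero_le) fun k => ?_
    refine (eLpNorm_sub_le (mφ k).1.1 (mψ k).1.1 hp1).trans ?_
    exact add_le_add (eLpNorm_le_w1Norm Ω hp0 _) (eLpNorm_le_w1Norm Ω hp0 _)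
  · refine tendsto_of_tendsto_of_tendsto_of_le_of_le tendsto_const_nhds hsum
      (fun k => zero_le) fun k => ?_
    dsimp only
    rw [eLpNorm_congr_ae ((mφ k).weakGradient_sub hΩ (mψ k))]
    refine (eLpNorm_sub_le ((mφ k).memLp_weakGradient hΩ).1
      ((mψ k).memLp_weakGradient hΩ).1 hp1).trans ?_
    exact add_le_add (eLpNorm_weakGradient_le_w1Norm Ω hp0 _)
      (eLpNorm_weakGradient_le_w1Norm Ω hp0 _)

/-! ### Norms as integrals of powers, and Poincaré's inequality -/

theorem eLpNorm_ofReal_eq {E : Type*} [NormedAddCommGroup E] {ν : Measure Plane} {p : ℝ}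
    (hp : 0 < p) {f : Plane → E} (hf : MemLp f (ENNReal.ofReal p) ν) :
    eLpNorm f (ENNReal.ofReal p) ν = ENNReal.ofReal ((∫ x, ‖f x‖ ^ p ∂ν) ^ (1 / p)) := by
  rw [hf.eLpNorm_eq_integral_rpow_norm (by simpa using hp) (by simp), ENNReal.toReal_ofReal hp.le,
    one_div]

theorem eLpNorm_ofReal_rpow_eq {E : Type*} [NormedAddCommGroup E] {ν : Measure Plane} {p : ℝ}
    (hp : 0 < p) {f : Plane → E} (hf : MemLp f (ENNReal.ofReal p) ν) :
    eLpNorm f (ENNReal.ofReal p) ν ^ p = ENNReal.ofReal (∫ x, ‖f x‖ ^ p ∂ν) := by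
  have h0 : 0 ≤ ∫ x, ‖f x‖ ^ p ∂ν := integral_nonneg fun x => by positivity
  rw [eLpNorm_ofReal_eq hp hf, ENNReal.ofReal_rpow_of_nonneg (by positivity) hp.le,
    ← Real.rpow_mul h0, one_div_mul_cancel hp.ne', Real.rpow_one]

theorem w1Norm_rpow_eq {Ω : Set Plane} (hΩ : IsOpen Ω) {p : ℝ} (hp : 0 < p) {u : Plane → ℝ}
    (hu : MemW1 Ω p u) : w1Norm Ω p u ^ p =
      ENNReal.ofReal ((∫ x in Ω, |u x| ^ p) + ∫ x in Ω, ‖weakGradient Ω u x‖ ^ p) := by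
  unfold w1Norm
  rw [← ENNReal.rpow_mul, one_div_mul_cancel hp.ne', ENNReal.rpow_one,
    eLpNorm_ofReal_rpow_eq hp hu.1, eLpNorm_ofReal_rpow_eq hp (hu.memLp_weakGradient hΩ),
    ← ENNReal.ofReal_add (integral_nonneg fun x => by positivity)
      (integral_nonneg fun x => by positivity)]
  rfl

/-- The exponent `q = 2p/(p+2)` satisfies `1/q - 1/2 = 1/p`, so in the plane the Sobolev inequality
bounds the `L^p` norm by the `L^q` norm of the gradient. Since `q ≤ p` and `Ω` has finite measure,
Hölder's inequality returns to `L^p`. The condition `p ≥ 2` is what gives `q ≥ 1`. -/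
theorem IsTestFunction.eLpNorm_le {Ω : Set Plane} (hb : Bornology.IsBounded Ω) {p : ℝ}
    (hp : 2 ≤ p) : ∃ C : NNReal, ∀ φ : Plane → ℝ, IsTestFunction Ω φ →
      eLpNorm φ (ENNReal.ofReal p) (volume.restrict Ω) ≤
        C * eLpNorm (gradient φ) (ENNReal.ofReal p) (volume.restrict Ω) := by
  have hp0 : 0 < p := by linarith
  set q : ℝ := 2 * p / (p + 2) with hq
  have hq0 : 0 < q := by positivity
  have hqp : q ≤ p := by
    rw [hq, div_le_iff₀ (by linarith)]; nlinarith
  have hvol : volume Ω ≠ ⊤ := hb.measure_lt_top.ne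
  set K : ℝ≥0∞ := eLpNormLESNormFDerivOfLeConst ℝ (volume : Measure Plane) Ω q.toNNReal p.toNNReal *
    (volume Ω) ^ (1 / q - 1 / p) with hK
  have hKt : K ≠ ⊤ := by
    refine ENNReal.mul_ne_top ENNReal.coe_ne_top (ENNReal.rpow_ne_top_of_nonneg ?_ hvol)
    rw [sub_nonneg]
    exact one_div_le_one_div_of_le hq0 hqp
  refine ⟨K.toNNReal, fun φ hφ => ?_⟩
  rw [ENNReal.coe_toNNReal hKt]
  have h1 : eLpNorm φ (ENNReal.ofReal p) volume ≤
      eLpNormLESNormFDerivOfLeConst ℝ (volume : Measure Plane) Ω q.toNNReal p.toNNReal *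
        eLpNorm (fderiv ℝ φ) (ENNReal.ofReal q) volume := by
    refine eLpNorm_le_eLpNorm_fderiv_of_le (p := q.toNNReal) (q := p.toNNReal) (F := ℝ) volume
      (hφ.1.of_le (by simp)) (fun x hx => ?_) ?_ ?_ ?_ hb
    · by_contra h
      exact hx (eq_zero_of_notMem hφ h)
    · rw [← NNReal.coe_le_coe, Real.coe_toNNReal _ hq0.le, NNReal.coe_one, hq,
        le_div_iff₀ (by linarith)]
      linarith
    · rw [← NNReal.coe_lt_coe, Real.coe_toNNReal _ hq0.le, hq, div_lt_iff₀ (by linarith)]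
      simp
    · push_cast
      rw [Real.coe_toNNReal _ hq0.le, Real.coe_toNNReal _ hp0.le, hq]
      simp
      field_simp
      linarith
  have h2 : eLpNorm (fderiv ℝ φ) (ENNReal.ofReal q) volume =
      eLpNorm (gradient φ) (ENNReal.ofReal q) (volume.restrict Ω) := by
    rw [← eLpNorm_norm (fderiv ℝ φ), ← eLpNorm_norm (gradient φ)]
    simp only [norm_gradient]
    refine (eLpNorm_restrict_eq_of_support_subset fun x hx => ?_).symm
    by_contra h
    refine hx ?_
    have := norm_gradient φ x
    rw [gradient_eq_zero_of_notMem hφ h, norm_zero] at this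
    exact this.symm
  have h3 : eLpNorm (gradient φ) (ENNReal.ofReal q) (volume.restrict Ω) ≤
      eLpNorm (gradient φ) (ENNReal.ofReal p) (volume.restrict Ω) *
        (volume Ω) ^ (1 / q - 1 / p) := by
    have := eLpNorm_le_eLpNorm_mul_rpow_measure_univ (μ := volume.restrict Ω)
      (ENNReal.ofReal_le_ofReal hqp) (hφ.memLp_gradient (ENNReal.ofReal p)).1
    rwa [ENNReal.toReal_ofReal hq0.le, ENNReal.toReal_ofReal hp0.le,
      Measure.restrict_apply_univ] at this
  calc eLpNorm φ (ENNReal.ofReal p) (volume.restrict Ω)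
      ≤ eLpNorm φ (ENNReal.ofReal p) volume := eLpNorm_restrict_le _ _ _ _
    _ ≤ _ := h1
    _ ≤ _ := by
      rw [h2, hK, mul_assoc, mul_comm (volume Ω ^ _)]
      gcongr

/-- Poincaré's inequality in `W_0^{1,p}`. -/
theorem exists_poincare_eLpNorm {Ω : Set Plane} (hΩ : IsOpen Ω) (hb : Bornology.IsBounded Ω)
    {p : ℝ} (hp : 2 ≤ p) : ∃ C : NNReal, ∀ u : Plane → ℝ, MemW10 Ω p u →
      eLpNorm u (ENNReal.ofReal p) (volume.restrict Ω) ≤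
        C * eLpNorm (weakGradient Ω u) (ENNReal.ofReal p) (volume.restrict Ω) := by
  have hp0 : 0 < p := by linarith
  have hp1 : 1 ≤ ENNReal.ofReal p := by rw [ENNReal.one_le_ofReal]; linarith
  obtain ⟨C, hC⟩ := IsTestFunction.eLpNorm_le hb hp
  refine ⟨C, fun u hu => ?_⟩
  obtain ⟨hu1, φ, hφ, hl⟩ := hu
  -- With `e` the distance from `u` to `φ k`, the bound for `φ k` yields `‖u‖ ≤ e + C (e + ‖∇u‖)`;
  -- then `e → 0`.
  have hlim : Tendsto (fun k => w1Norm Ω p (fun x => u x - φ k x) +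
      C * (w1Norm Ω p (fun x => u x - φ k x) +
        eLpNorm (weakGradient Ω u) (ENNReal.ofReal p) (volume.restrict Ω))) atTop
      (𝓝 (0 + C * (0 + eLpNorm (weakGradient Ω u) (ENNReal.ofReal p) (volume.restrict Ω)))) :=
    hl.add (ENNReal.Tendsto.const_mul (hl.add tendsto_const_nhds) (Or.inr ENNReal.coe_ne_top))
  rw [zero_add, zero_add] at hlim
  refine ge_of_tendsto' hlim fun k => ?_
  have m := hu1.sub hΩ ((hφ k).memW1 p)
  have h1 : eLpNorm u (ENNReal.ofReal p) (volume.restrict Ω) ≤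
      w1Norm Ω p (fun x => u x - φ k x) + eLpNorm (φ k) (ENNReal.ofReal p) (volume.restrict Ω) := by
    have e : u = (fun x => u x - φ k x) + φ k := by ext x; simp
    calc _ = eLpNorm ((fun x => u x - φ k x) + φ k) _ _ := by rw [← e]
      _ ≤ _ := eLpNorm_add_le m.1.1 ((hφ k).memLp 1).1 hp1
      _ ≤ _ := by gcongr; exact eLpNorm_le_w1Norm Ω hp0 _
  have h2 : eLpNorm (gradient (φ k)) (ENNReal.ofReal p) (volume.restrict Ω) ≤
      w1Norm Ω p (fun x => u x - φ k x) +
        eLpNorm (weakGradient Ω u) (ENNReal.ofReal p) (volume.restrict Ω) := by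
    have e : gradient (φ k) =ᵐ[volume.restrict Ω]
        weakGradient Ω u - weakGradient Ω (fun x => u x - φ k x) := by
      filter_upwards [(hu1.hasWeakGradient.sub (hφ k).hasWeakGradient).weakGradient_ae_eq hΩ]
        with x hx
      simp [hx]
    rw [eLpNorm_congr_ae e, add_comm]
    refine (eLpNorm_sub_le (hu1.memLp_weakGradient hΩ).1 (m.memLp_weakGradient hΩ).1 hp1).trans ?_
    gcongr
    exact eLpNorm_weakGradient_le_w1Norm Ω hp0 _
  refine h1.trans ?_
  gcongr
  exact (hC _ (hφ k)).trans (by gcongr)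

/-- Poincaré's inequality for the integrals of the `p`-th powers. -/
theorem exists_poincare {Ω : Set Plane} (hΩ : IsOpen Ω) (hb : Bornology.IsBounded Ω)
    {p : ℝ} (hp : 2 ≤ p) : ∃ C : ℝ, 0 < C ∧ ∀ u : Plane → ℝ, MemW10 Ω p u →
      ∫ x in Ω, |u x| ^ p ≤ C * ∫ x in Ω, ‖weakGradient Ω u x‖ ^ p := by
  have hp0 : 0 < p := by linarith
  obtain ⟨C, hC⟩ := exists_poincare_eLpNorm hΩ hb hp
  have hCp : (0 : ℝ) ≤ (C : ℝ) ^ p := by positivity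
  -- The added 1 makes the constant positive, so that it may later stand in a denominator.
  refine ⟨(C : ℝ) ^ p + 1, by positivity, fun u hu => ?_⟩
  have hG : 0 ≤ ∫ x in Ω, ‖weakGradient Ω u x‖ ^ p := integral_nonneg fun x => by positivity
  have h := ENNReal.rpow_le_rpow (hC u hu) hp0.le
  rw [ENNReal.mul_rpow_of_nonneg _ _ hp0.le, eLpNorm_ofReal_rpow_eq hp0 hu.1.1,
    eLpNorm_ofReal_rpow_eq hp0 (hu.1.memLp_weakGradient hΩ), ← ENNReal.ofReal_coe_nnreal,
    ENNReal.ofReal_rpow_of_nonneg (by positivity) hp0.le, ← ENNReal.ofReal_mul hCp,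
    ENNReal.ofReal_le_ofReal_iff (by positivity)] at h
  simp only [Real.norm_eq_abs] at h
  linarith

/-! ### Functions of time -/

section Time

variable {X : Type*} [NormedAddCommGroup X] [NormedSpace ℝ X]

theorem exists_Icc_of_isCompact {K : Set ℝ} {T : ℝ} (hK : IsCompact K) (hT : 0 < T)
    (hsub : K ⊆ Set.Ioo 0 T) : ∃ b c, 0 < b ∧ c < T ∧ K ⊆ Set.Icc b c := by
  rcases K.eq_empty_or_nonempty with rfl | hne
  · exact ⟨T / 2, T / 2, by linarith, by linarith, Set.empty_subset _⟩
  · exact ⟨sInf K, sSup K, (hsub (hK.sInf_mem hne)).1, (hsub (hK.sSup_mem hne)).2, fun x hx =>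
      ⟨csInf_le hK.bddBelow hx, le_csSup hK.bddAbove hx⟩⟩

/-- A test function on `(0,T)` of zero mean is the derivative of a test function. -/
theorem exists_deriv_eq_of_integral_eq_zero {T : ℝ} (hT : 0 < T) {ψ : ℝ → ℝ}
    (h1 : ContDiff ℝ ∞ ψ) (h2 : HasCompactSupport ψ) (h3 : tsupport ψ ⊆ Set.Ioo 0 T)
    (h4 : ∫ t, ψ t = 0) : ∃ Ψ : ℝ → ℝ, ContDiff ℝ ∞ Ψ ∧ HasCompactSupport Ψ ∧
      tsupport Ψ ⊆ Set.Ioo 0 T ∧ deriv Ψ = ψ := by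
  obtain ⟨b, c, hb, hc, hbc⟩ := exists_Icc_of_isCompact h2 hT h3
  have hz : ∀ t, t ∉ Set.Icc b c → ψ t = 0 := fun t ht =>
    image_eq_zero_of_notMem_tsupport fun h => ht (hbc h)
  -- Integrating from `b` makes the primitive vanish to the left of the support; the zero mean makes
  -- it vanish to the right.
  set Ψ : ℝ → ℝ := fun t => ∫ s in b..t, ψ s with hΨ
  have hd : ∀ t, HasDerivAt Ψ (ψ t) t := fun t =>
    intervalIntegral.integral_hasDerivAt_right (h1.continuous.intervalIntegrable _ _)
      h1.continuous.stronglyMeasurable.stronglyMeasurableAtFilter h1.continuous.continuousAt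
  have hdd : deriv Ψ = ψ := funext fun t => (hd t).deriv
  have hi : Integrable ψ := h1.continuous.integrable_of_hasCompactSupport h2
  have hts : tsupport Ψ ⊆ Set.Icc b c := by
    refine closure_minimal (fun t ht => ?_) isClosed_Icc
    by_contra hn
    refine ht ?_
    rcases lt_or_ge t b with h | h
    · rw [hΨ]
      refine intervalIntegral.integral_zero_ae ?_
      have : ∀ᵐ x : ℝ, x ≠ b := by simp [ae_iff]
      filter_upwards [this] with x hxb hx
      rw [Set.uIoc_of_ge h.le] at hx
      exact hz x fun h' => hxb (le_antisymm hx.2 h'.1)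
    · have htc : c < t := by
        by_contra! h'
        exact hn ⟨h, h'⟩
      change ∫ s in b..t, ψ s = 0
      rw [intervalIntegral.integral_of_le h, ← h4, ← integral_Icc_eq_integral_Ioc]
      refine setIntegral_eq_integral_of_forall_compl_eq_zero fun x hx => hz x fun h' => hx ?_
      exact ⟨h'.1, h'.2.trans htc.le⟩
  refine ⟨Ψ, ?_, HasCompactSupport.of_support_subset_isCompact isCompact_Icc
    (subset_closure.trans hts), hts.trans fun x hx => ⟨hb.trans_le hx.1, hx.2.trans_lt hc⟩, hdd⟩
  rw [contDiff_infty_iff_deriv, hdd]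
  exact ⟨fun t => (hd t).differentiableAt, h1⟩

theorem exists_testFunction_integral_eq_one {T : ℝ} (hT : 0 < T) :
    ∃ φ : ℝ → ℝ, ContDiff ℝ ∞ φ ∧ HasCompactSupport φ ∧ tsupport φ ⊆ Set.Ioo 0 T ∧
      ∫ t, φ t = 1 := by
  let B : ContDiffBump (T / 2) := ⟨T / 8, T / 4, by linarith, by linarith⟩
  refine ⟨B.normed volume, B.contDiff_normed, B.hasCompactSupport_normed, ?_, B.integral_normed⟩
  rw [B.tsupport_normed_eq]
  intro x hx
  rw [Metric.mem_closedBall, Real.dist_eq, abs_le] at hx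
  have : B.rOut = T / 4 := rfl
  rw [this] at hx
  constructor <;> linarith [hx.1, hx.2]

/-- The du Bois-Reymond lemma. -/
theorem ae_eq_const_of_integral_deriv_smul_eq_zero [CompleteSpace X] {T : ℝ} (hT : 0 < T)
    {w : ℝ → X} (hw : IntegrableOn w (Set.Ioo 0 T))
    (h : ∀ φ : ℝ → ℝ, ContDiff ℝ ∞ φ → HasCompactSupport φ → tsupport φ ⊆ Set.Ioo 0 T →
      ∫ t in Set.Ioo 0 T, deriv φ t • w t = 0) :
    ∃ c : X, ∀ᵐ t ∂volume.restrict (Set.Ioo 0 T), w t = c := by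
  obtain ⟨φ₀, a1, a2, a3, a4⟩ := exists_testFunction_integral_eq_one hT
  have hint : ∀ φ : ℝ → ℝ, ContDiff ℝ ∞ φ → HasCompactSupport φ →
      IntegrableOn (fun t => φ t • w t) (Set.Ioo 0 T) := by
    intro φ h1 h2
    obtain ⟨C, hC⟩ := h2.exists_bound_of_continuous h1.continuous
    exact Integrable.bdd_smul hw C h1.continuous.aestronglyMeasurable (ae_of_all _ hC)
  -- The constant must be the mean of `w` against the normalised bump `φ₀`. For any `φ`, the
  -- function `φ - (∫ φ) φ₀` has zero mean, hence is the derivative of an admissible test function.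
  obtain ⟨c, hc⟩ : ∃ c : X, c = ∫ t in Set.Ioo 0 T, φ₀ t • w t := ⟨_, rfl⟩
  refine ⟨c, ?_⟩
  have key := isOpen_Ioo.ae_eq_zero_of_integral_contDiff_smul_eq_zero (μ := volume)
    (f := fun t => w t - c) (U := Set.Ioo 0 T)
    (hw.sub (integrableOn_const (by simp))).locallyIntegrableOn ?_
  · rw [ae_restrict_iff' measurableSet_Ioo]
    filter_upwards [key] with t ht htm
    exact sub_eq_zero.1 (ht htm)
  intro φ h1 h2 h3
  have hi : Integrable φ := h1.continuous.integrable_of_hasCompactSupport h2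
  have hi₀ : Integrable φ₀ := a1.continuous.integrable_of_hasCompactSupport a2
  have hφz : ∀ t, t ∉ Set.Ioo 0 T → φ t = 0 := fun t ht =>
    image_eq_zero_of_notMem_tsupport fun h => ht (h3 h)
  have hφI : ∫ t in Set.Ioo 0 T, φ t = ∫ t, φ t :=
    setIntegral_eq_integral_of_forall_compl_eq_zero hφz
  rw [← setIntegral_eq_integral_of_forall_compl_eq_zero (s := Set.Ioo 0 T)
    (fun x hx => by rw [hφz x hx, zero_smul])]
  simp only [smul_sub]
  rw [integral_sub (hint φ h1 h2) (hi.integrableOn.smul_const c), integral_smul_const, hφI, hc,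
    ← integral_smul]
  have h5 : IntegrableOn (fun t => (∫ t, φ t) • φ₀ t • w t) (Set.Ioo 0 T) := (hint φ₀ a1 a2).smul _
  rw [← integral_sub (hint φ h1 h2) h5]
  have hzero : ∫ t, (φ - (∫ t, φ t) • φ₀) t = 0 := by
    simp only [Pi.sub_apply, Pi.smul_apply, smul_eq_mul]
    rw [integral_sub hi (hi₀.const_mul _), integral_const_mul, a4, mul_one, sub_self]
  have hcs : HasCompactSupport ((∫ t, φ t) • φ₀) :=
    a2.of_isClosed_subset (isClosed_tsupport _) (tsupport_smul_subset_right (fun _ => ∫ t, φ t) φ₀)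
  have hts : tsupport ((∫ t, φ t) • φ₀) ⊆ Set.Ioo 0 T :=
    (tsupport_smul_subset_right (fun _ => ∫ t, φ t) φ₀).trans a3
  have hcd : ContDiff ℝ ∞ ((∫ t, φ t) • φ₀) :=
    contDiff_const.mul a1
  obtain ⟨Ψ, b1, b2, b3, b4⟩ := exists_deriv_eq_of_integral_eq_zero hT (h1.sub hcd) (h2.sub hcs)
    ((tsupport_sub _ _).trans (Set.union_subset h3 hts)) hzero
  refine Eq.trans (integral_congr_ae (ae_of_all _ fun t => ?_)) (h Ψ b1 b2 b3)
  simp only [b4, Pi.smul_apply, smul_eq_mul, sub_smul, smul_smul]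

theorem integrable_indicator_lt_smul {f : ℝ → ℝ} {g : ℝ → X} (hf : Integrable f)
    (hg : Integrable g) : Integrable (fun z : ℝ × ℝ => (Set.Iio z.1).indicator
      (fun s => f z.1 • g s) z.2) (volume.prod volume) := by
  have h := (hf.smul_prod hg).indicator (measurableSet_lt measurable_snd measurable_fst)
  refine h.congr (ae_of_all _ fun z => ?_)
  simp [Set.indicator]

/-- Integration by parts against the primitive of an integrable function. -/
theorem integral_deriv_smul_primitive [CompleteSpace X] {φ : ℝ → ℝ} {g : ℝ → X}
    (h1 : ContDiff ℝ ∞ φ) (h2 : HasCompactSupport φ) (hg : Integrable g) :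
    ∫ t, deriv φ t • ∫ s in Set.Iio t, g s = -∫ s, φ s • g s := by
  have hd : Continuous (deriv φ) := h1.continuous_deriv (by simp)
  have hdi : Integrable (deriv φ) := hd.integrable_of_hasCompactSupport h2.deriv
  have e1 : ∀ t, deriv φ t • ∫ s in Set.Iio t, g s =
      ∫ s, (Set.Iio t).indicator (fun s => deriv φ t • g s) s := fun t => by
    rw [integral_indicator measurableSet_Iio, integral_smul]
  simp only [e1]
  -- After Fubini on `{s < t}` the inner integral of `deriv φ` over `(s, ∞)` is `-φ s`.
  rw [integral_integral_swap (integrable_indicator_lt_smul hdi hg), ← integral_neg]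
  refine integral_congr_ae (ae_of_all _ fun s => ?_)
  have e2 : ∀ t, (Set.Iio t).indicator (fun s => deriv φ t • g s) s =
      (Set.Ioi s).indicator (fun t => deriv φ t • g s) t := fun t => by
    simp [Set.indicator]
  simp only [e2]
  rw [integral_indicator measurableSet_Ioi, integral_smul_const,
    h2.integral_Ioi_deriv_eq (h1.of_le (by simp)), neg_smul]

/-- Members of `W^{1,p}(0,T;X)` are primitives of integrable functions. -/
theorem MemW1Time.exists_primitive [CompleteSpace X] {T p : ℝ} (hT : 0 < T) (hp : 1 ≤ p)
    {a : ℝ → X} (ha : MemW1Time T p a) : ∃ (c : X) (g : ℝ → X), Integrable g ∧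
      ∀ᵐ t ∂volume.restrict (Set.Ioo 0 T), a t = c + ∫ s in Set.Iio t, g s := by
  have hp1 : 1 ≤ ENNReal.ofReal p := by simpa using hp
  obtain ⟨haL, a', ha'L, hw⟩ := ha
  have hai : IntegrableOn a (Set.Ioo 0 T) := haL.integrable hp1
  have ha'i : IntegrableOn a' (Set.Ioo 0 T) := ha'L.integrable hp1
  set g : ℝ → X := (Set.Ioo 0 T).indicator a' with hg
  have hgi : Integrable g := (integrable_indicator_iff measurableSet_Ioo).2 ha'i
  have hAm : IntegrableOn (fun t => ∫ s in Set.Iio t, g s) (Set.Ioo 0 T) := by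
    have h1 := (integrable_indicator_lt_smul
      ((integrable_indicator_iff (measurableSet_Ioo (a := (0 : ℝ)) (b := T))).2
        (integrableOn_const (C := (1 : ℝ)) (by simp))) hgi).integral_prod_left
    refine h1.integrableOn.congr ?_
    filter_upwards [ae_restrict_mem measurableSet_Ioo] with t ht
    rw [integral_indicator measurableSet_Iio]
    simp [ht]
  -- The difference between `a` and the primitive of its weak derivative has zero weak derivative.
  have key := ae_eq_const_of_integral_deriv_smul_eq_zero hT (hai.sub hAm) ?_
  · obtain ⟨c, hc⟩ := key
    refine ⟨c, g, hgi, ?_⟩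
    filter_upwards [hc] with t ht
    rw [← ht]
    exact (sub_add_cancel _ _).symm
  intro φ h1 h2 h3
  have hd : Continuous (deriv φ) := h1.continuous_deriv (by simp)
  obtain ⟨C, hC⟩ := h2.deriv.exists_bound_of_continuous hd
  have hz : ∀ t, t ∉ Set.Ioo 0 T → deriv φ t = 0 := fun t ht =>
    image_eq_zero_of_notMem_tsupport fun h => ht (h3 (tsupport_deriv_subset h))
  simp only [Pi.sub_apply, smul_sub]
  have i1 : IntegrableOn (fun t => deriv φ t • a t) (Set.Ioo 0 T) :=
    Integrable.bdd_smul hai C hd.aestronglyMeasurable (ae_of_all _ hC)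
  have i2 : IntegrableOn (fun t => deriv φ t • ∫ s in Set.Iio t, g s) (Set.Ioo 0 T) :=
    Integrable.bdd_smul hAm C hd.aestronglyMeasurable (ae_of_all _ hC)
  have i3 : ∫ t in Set.Ioo 0 T, deriv φ t • ∫ s in Set.Iio t, g s =
      ∫ t, deriv φ t • ∫ s in Set.Iio t, g s :=
    setIntegral_eq_integral_of_forall_compl_eq_zero fun x hx => by rw [hz x hx, zero_smul]
  rw [integral_sub i1 i2, hw φ h1 h2 h3, i3, integral_deriv_smul_primitive h1 h2 hgi, sub_eq_zero,
    neg_inj, ← integral_indicator measurableSet_Ioo]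
  refine integral_congr_ae (ae_of_all _ fun t => ?_)
  rw [hg]
  by_cases ht : t ∈ Set.Ioo 0 T <;> simp [ht]

theorem monotone_setIntegral_Iio_norm {X : Type*} [NormedAddCommGroup X] {g : ℝ → X} (hg : Integrable g) :
    Monotone fun t : ℝ => ∫ s in Set.Iio t, ‖g s‖ := fun _ _ h =>
  setIntegral_mono_set hg.norm.integrableOn (ae_of_all _ fun _ => norm_nonneg _)
    (Set.Iio_subset_Iio h).eventuallyLE

/-- The increments of the primitive are dominated by those of a bounded nondecreasing scalar
function, whose sums telescope. -/
theorem norm_primitive_sub_le {g : ℝ → X} (hg : Integrable g) {s t : ℝ} (hst : s ≤ t) :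
    ‖(∫ r in Set.Iio t, g r) - ∫ r in Set.Iio s, g r‖ ≤
      (∫ r in Set.Iio t, ‖g r‖) - ∫ r in Set.Iio s, ‖g r‖ := by
  have hsub : Set.Iio s ⊆ Set.Iio t := Set.Iio_subset_Iio hst
  rw [← setIntegral_sdiff measurableSet_Iio hg.integrableOn hsub,
    ← setIntegral_sdiff measurableSet_Iio hg.norm.integrableOn hsub]
  exact norm_integral_le_integral_norm _

/-- The averages of a `W^{1,p}(0,T;X)` function over a uniform partition are bounded and of bounded
variation, uniformly in the partition. -/
theorem MemW1Time.exists_bound_average [CompleteSpace X] {T p : ℝ} (hT : 0 < T) (hp : 1 ≤ p)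
    {a : ℝ → X} (ha : MemW1Time T p a) : ∃ K : ℝ, 0 < K ∧ ∀ N : ℕ, 1 ≤ N → ∀ A : ℕ → X,
      (∀ n, A n = (1 / step T N) • ∫ t in (n * step T N)..((n + 1) * step T N), a t) →
      (∀ n < N, ‖A n‖ ≤ K) ∧ ∑ n ∈ Finset.range (N - 1), ‖A (n + 1) - A n‖ ≤ K := by
  obtain ⟨c, g, hg, hag⟩ := ha.exists_primitive hT hp
  set V : ℝ → ℝ := fun t => ∫ s in Set.Iio t, ‖g s‖ with hV
  set B : ℝ → X := fun t => c + ∫ s in Set.Iio t, g s with hB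
  set W : ℝ := ∫ s, ‖g s‖ with hW
  have hVm : Monotone V := monotone_setIntegral_Iio_norm hg
  have hV0 : ∀ t, 0 ≤ V t := fun t => integral_nonneg fun _ => norm_nonneg _
  have hVW : ∀ t, V t ≤ W := fun t =>
    setIntegral_le_integral hg.norm (ae_of_all _ fun _ => norm_nonneg _)
  have hW0 : 0 ≤ W := integral_nonneg fun _ => norm_nonneg _
  have hBb : ∀ t, ‖B t‖ ≤ ‖c‖ + W := fun t =>
    (norm_add_le _ _).trans (add_le_add_right
      ((norm_integral_le_integral_norm _).trans (hVW t)) _)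
  refine ⟨‖c‖ + W + 1, by positivity, fun N hN A hA => ?_⟩
  have hN0 : (0 : ℝ) < N := by exact_mod_cast hN
  set l : ℝ := step T N with hl
  have hl0 : 0 < l := div_pos hT hN0
  have hlN : N * l = T := by rw [hl, step]; field_simp
  have hai : IntegrableOn a (Set.Ioo 0 T) := ha.1.integrable (by simpa using hp)
  have hBi : IntegrableOn B (Set.Ioo 0 T) := hai.congr hag
  have hin : ∀ n : ℕ, n < N → Set.Ioo (n * l) ((n + 1) * l) ⊆ Set.Ioo 0 T := by
    intro n hn
    have : ((n : ℝ) + 1) ≤ N := by exact_mod_cast hn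
    refine Set.Ioo_subset_Ioo (by positivity) ?_
    rw [← hlN]; gcongr
  have hle : ∀ n : ℕ, n * l ≤ (n + 1) * l := fun n => by nlinarith
  -- Shifting every average to the same interval `[0, l]` lets consecutive averages be compared
  -- pointwise.
  have hAB : ∀ n < N, A n = (1 / l) • ∫ s in (0 : ℝ)..l, B (n * l + s) := by
    intro n hn
    rw [hA, intervalIntegral.integral_comp_add_left]
    congr 1
    rw [add_zero, show n * l + l = (n + 1) * l by ring, intervalIntegral.integral_of_le (hle n),
      intervalIntegral.integral_of_le (hle n), integral_Ioc_eq_integral_Ioo,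
      integral_Ioc_eq_integral_Ioo]
    exact integral_congr_ae (ae_restrict_of_ae_restrict_of_subset (hin n hn) hag)
  have hBint : ∀ n < N, IntervalIntegrable (fun s => B (n * l + s)) volume 0 l := by
    intro n hn
    have h1 : IntervalIntegrable B volume (n * l) ((n + 1) * l) := by
      rw [intervalIntegrable_iff_integrableOn_Ioo_of_le (hle n)]
      exact hBi.mono_set (hin n hn)
    have h2 := h1.comp_add_left (n * l)
    rwa [sub_self, show (n + 1) * l - n * l = l by ring] at h2
  have hVint : ∀ n : ℕ, IntervalIntegrable (fun s => V (n * l + s)) volume 0 l := fun n =>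
    Monotone.intervalIntegrable fun _ _ h => hVm (by gcongr)
  refine ⟨fun n hn => ?_, ?_⟩
  · rw [hAB n hn, norm_smul, Real.norm_of_nonneg (by positivity)]
    have h1 := intervalIntegral.norm_integral_le_of_norm_le_const (a := 0) (b := l)
      (f := fun s => B (n * l + s)) (C := ‖c‖ + W) fun s _ => hBb _
    rw [sub_zero, abs_of_pos hl0] at h1
    calc 1 / l * ‖∫ s in (0 : ℝ)..l, B (n * l + s)‖ ≤ 1 / l * ((‖c‖ + W) * l) := by gcongr
      _ = ‖c‖ + W := by field_simp
      _ ≤ _ := by linarith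
  · set v : ℕ → ℝ := fun n => (1 / l) * ∫ s in (0 : ℝ)..l, V (n * l + s) with hv
    -- Only differences of averages with both indices below `N` occur: the average with index `N`
    -- would leave `(0, T)`.
    have hdiff : ∀ n ∈ Finset.range (N - 1), ‖A (n + 1) - A n‖ ≤ v (n + 1) - v n := by
      intro n hn
      rw [Finset.mem_range] at hn
      rw [hAB n (by omega), hAB (n + 1) (by omega), ← smul_sub,
        ← intervalIntegral.integral_sub (hBint _ (by omega)) (hBint _ (by omega)), norm_smul,
        Real.norm_of_nonneg (by positivity), hv]
      dsimp only
      rw [← mul_sub, ← intervalIntegral.integral_sub (hVint _) (hVint _)]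
      gcongr
      refine intervalIntegral.norm_integral_le_of_norm_le hl0.le (ae_of_all _ fun s _ => ?_)
        ((hVint _).sub (hVint _))
      simp only [hB, add_sub_add_left_eq_sub]
      refine norm_primitive_sub_le hg ?_
      push_cast
      nlinarith
    have hv0 : 0 ≤ v 0 := mul_nonneg (by positivity)
      (intervalIntegral.integral_nonneg hl0.le fun s _ => hV0 _)
    have hvW : v (N - 1) ≤ W := by
      have : ∫ s in (0 : ℝ)..l, V ((N - 1 : ℕ) * l + s) ≤ ∫ _ in (0 : ℝ)..l, W :=
        intervalIntegral.integral_mono_on hl0.le (hVint _) (by simp) fun s _ => hVW _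
      rw [intervalIntegral.integral_const, sub_zero, smul_eq_mul] at this
      calc v (N - 1) ≤ 1 / l * (l * W) := by rw [hv]; dsimp only; gcongr
        _ = W := by field_simp
    calc _ ≤ ∑ n ∈ Finset.range (N - 1), (v (n + 1) - v n) := Finset.sum_le_sum hdiff
      _ = v (N - 1) - v 0 := Finset.sum_range_sub v _
      _ ≤ _ := by linarith [norm_nonneg c]

end Time

/-! ### The energy estimate -/

theorem MemLp.integrable_abs_rpow {ν : Measure Plane} {p : ℝ} (hp : 0 < p) {u : Plane → ℝ}
    (hu : MemLp u (ENNReal.ofReal p) ν) : Integrable (fun x => |u x| ^ p) ν := by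
  have := hu.integrable_norm_rpow (by simpa using hp) (by simp)
  simpa [ENNReal.toReal_ofReal hp.le] using this

theorem MemLp.integrable_norm_rpow_ofReal {ν : Measure Plane} {p : ℝ} (hp : 0 < p)
    {g : Plane → Plane} (hg : MemLp g (ENNReal.ofReal p) ν) :
    Integrable (fun x => ‖g x‖ ^ p) ν := by
  have := hg.integrable_norm_rpow (by simpa using hp) (by simp)
  simpa [ENNReal.toReal_ofReal hp.le] using this

/-- Cauchy–Schwarz and the bound of `‖ξ‖^(p-1) ‖η‖` by pure powers. This serves both for
integrability of the flux and for its dual estimate. -/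
theorem abs_flux_le {E : Type*} [NormedAddCommGroup E] [InnerProductSpace ℝ E] {p m m₂ : ℝ}
    (hp : 2 ≤ p) (hm : 0 ≤ m) (hm₂ : m ≤ m₂) (ξ η : E) :
    |m * (‖ξ‖ ^ (p - 2) * inner ℝ ξ η)| ≤ m₂ * (‖ξ‖ ^ p + ‖η‖ ^ p) := by
  have h1 : ‖ξ‖ ^ (p - 2) * (‖ξ‖ * ‖η‖) = ‖ξ‖ ^ (p - 1) * ‖η‖ := by
    rw [← mul_assoc, ← Real.rpow_add_one' (norm_nonneg _) (by linarith)]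
    congr 2; ring
  have h2 := rpow_mul_le_rpow_add_rpow (norm_nonneg ξ) (norm_nonneg η) (q := p - 1) (by linarith)
  rw [sub_add_cancel] at h2
  rw [abs_mul, abs_mul, abs_of_nonneg hm, abs_of_nonneg (by positivity : 0 ≤ ‖ξ‖ ^ (p - 2))]
  calc _ ≤ m₂ * (‖ξ‖ ^ (p - 2) * (‖ξ‖ * ‖η‖)) := by
        gcongr
        · linarith
        · exact abs_real_inner_le_norm ξ η
    _ ≤ _ := by
        rw [h1]
        exact mul_le_mul_of_nonneg_left h2 (by linarith)

section Integrability

variable {ν : Measure Plane} [IsFiniteMeasure ν] {p : ℝ} {u v : Plane → ℝ}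

theorem integrable_two_add_add (hp : 0 < p) (hu : MemLp u (ENNReal.ofReal p) ν)
    (hv : MemLp v (ENNReal.ofReal p) ν) :
    Integrable (fun x => 2 + |u x| ^ p + |v x| ^ p) ν :=
  ((integrable_const 2).add (MemLp.integrable_abs_rpow hp hu)).add
    (MemLp.integrable_abs_rpow hp hv)

theorem integrable_oddPow_mul {q : ℝ} (hq : -1 < q) (hqp : q + 2 ≤ p)
    (hu : MemLp u (ENNReal.ofReal p) ν) (hv : MemLp v (ENNReal.ofReal p) ν) :
    Integrable (fun x => oddPow q (u x) * v x) ν := by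
  refine (integrable_two_add_add (by linarith) hu hv).mono'
    (((measurable_oddPow q).comp_aemeasurable hu.1.aemeasurable).mul
      hv.1.aemeasurable).aestronglyMeasurable (ae_of_all _ fun x => ?_)
  rw [Real.norm_eq_abs, abs_mul, abs_oddPow hq]
  exact rpow_mul_le_one_add (abs_nonneg _) (abs_nonneg _) (by linarith) (by linarith)

theorem abs_negPart_mul_le (hp : 2 ≤ p) (s t : ℝ) :
    |negPart s * t| ≤ 2 + |s| ^ p + |t| ^ p := by
  rw [abs_mul, abs_of_nonneg (negPart_nonneg _)]
  calc _ ≤ |s| ^ (1 : ℝ) * |t| := by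
        rw [Real.rpow_one]; gcongr; exact negPart_le_abs _
    _ ≤ _ := rpow_mul_le_one_add (abs_nonneg _) (abs_nonneg _) (by linarith) (by linarith)

theorem integrable_negPart_mul (hp : 2 ≤ p)
    (hu : MemLp u (ENNReal.ofReal p) ν) (hv : MemLp v (ENNReal.ofReal p) ν) :
    Integrable (fun x => negPart (u x) * v x) ν :=
  (integrable_two_add_add (by linarith) hu hv).mono'
    ((measurable_negPart.comp_aemeasurable hu.1.aemeasurable).mul
      hv.1.aemeasurable).aestronglyMeasurable (ae_of_all _ fun _ => abs_negPart_mul_le hp _ _)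

theorem integrable_negPart_sq (hp : 2 ≤ p) (hu : MemLp u (ENNReal.ofReal p) ν) :
    Integrable (fun x => negPart (u x) ^ 2) ν := by
  refine (integrable_two_add_add (by linarith) hu hu).mono'
    ((measurable_negPart.comp_aemeasurable hu.1.aemeasurable).pow_const 2).aestronglyMeasurable
    (ae_of_all _ fun x => ?_)
  have h := abs_negPart_mul_le hp (u x) (u x)
  rw [abs_mul] at h
  rw [Real.norm_eq_abs, abs_of_nonneg (sq_nonneg _), sq]
  refine le_trans ?_ h
  rw [abs_of_nonneg (negPart_nonneg _)]
  exact mul_le_mul_of_nonneg_left (negPart_le_abs _) (negPart_nonneg _)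

end Integrability

theorem integrable_flux {ν : Measure Plane} {p : ℝ} {μ : Plane → ℝ} {μ₂ : ℝ} {g h : Plane → Plane} (hp : 2 ≤ p)
    (hμ : AEMeasurable μ ν) (hμb : ∀ᵐ x ∂ν, 0 ≤ μ x ∧ μ x ≤ μ₂)
    (hg : MemLp g (ENNReal.ofReal p) ν) (hh : MemLp h (ENNReal.ofReal p) ν) :
    Integrable (fun x => μ x * (‖g x‖ ^ (p - 2) * inner ℝ (g x) (h x))) ν := by
  refine (((MemLp.integrable_norm_rpow_ofReal (by linarith) hg).add
    (MemLp.integrable_norm_rpow_ofReal (by linarith) hh)).const_mul μ₂).mono'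
    (hμ.mul ((hg.1.norm.aemeasurable.pow_const _).mul
      (hg.1.inner hh.1).aemeasurable)).aestronglyMeasurable ?_
  filter_upwards [hμb] with x hx
  exact abs_flux_le hp hx.1 hx.2 (g x) (h x)

theorem abs_extendZero_le {Ω : Set Plane} (f : closure Ω →ᵇ ℝ) (x : Plane) :
    |extendZero f x| ≤ ‖f‖ := by
  unfold extendZero
  split_ifs with h
  · exact f.norm_coe_le_norm _
  · simp

theorem extendZero_sub {Ω : Set Plane} (f g : closure Ω →ᵇ ℝ) (x : Plane) :
    extendZero (f - g) x = extendZero f x - extendZero g x := by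
  unfold extendZero
  split_ifs with h <;> simp

theorem aestronglyMeasurable_extendZero {Ω : Set Plane} (f : closure Ω →ᵇ ℝ) :
    AEStronglyMeasurable (extendZero f) (volume.restrict Ω) := by
  have hc : ContinuousOn (extendZero f) (closure Ω) := by
    rw [continuousOn_iff_continuous_domRestrict]
    refine f.continuous.congr fun x => ?_
    simp [extendZero]
  exact (hc.aestronglyMeasurable isClosed_closure.measurableSet).mono_measure
    (Measure.restrict_mono subset_closure le_rfl)

theorem integrable_extendZero_mul {Ω : Set Plane} (f : closure Ω →ᵇ ℝ) {v : Plane → ℝ}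
    (hv : Integrable v (volume.restrict Ω)) :
    Integrable (fun x => extendZero f x * v x) (volume.restrict Ω) :=
  hv.bdd_mul (aestronglyMeasurable_extendZero f) (ae_of_all _ (abs_extendZero_le f))

theorem abs_integral_extendZero_mul_le {Ω : Set Plane} (f : closure Ω →ᵇ ℝ) {v : Plane → ℝ}
    (hv : Integrable v (volume.restrict Ω)) :
    |∫ x in Ω, extendZero f x * v x| ≤ ‖f‖ * ∫ x in Ω, |v x| := by
  rw [← integral_const_mul, ← Real.norm_eq_abs]
  refine norm_integral_le_of_norm_le (hv.abs.const_mul _) (ae_of_all _ fun x => ?_)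
  rw [Real.norm_eq_abs, abs_mul]
  gcongr
  exact abs_extendZero_le f x

theorem isFiniteMeasure_restrict_of_isBounded {Ω : Set Plane} (hb : Bornology.IsBounded Ω) :
    IsFiniteMeasure (volume.restrict Ω) :=
  ⟨by rw [Measure.restrict_apply_univ]; exact hb.measure_lt_top⟩

theorem ae_bounds {Ω : Set Plane} (hΩ : IsOpen Ω) {μ : Plane → ℝ} {μ₁ μ₂ : ℝ}
    (hμb : ∀ x ∈ closure Ω, μ₁ ≤ μ x ∧ μ x ≤ μ₂) :
    ∀ᵐ x ∂(volume.restrict Ω), μ₁ ≤ μ x ∧ μ x ≤ μ₂ := by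
  filter_upwards [ae_restrict_mem hΩ.measurableSet] with x hx using hμb x (subset_closure hx)

theorem integrable_mul_norm_rpow {ν : Measure Plane} {p : ℝ} (hp : 0 < p) {μ : Plane → ℝ}
    {μ₁ μ₂ : ℝ} (hμ₁ : 0 < μ₁) (hμ : AEMeasurable μ ν) (hμb : ∀ᵐ x ∂ν, μ₁ ≤ μ x ∧ μ x ≤ μ₂)
    {g : Plane → Plane} (hg : MemLp g (ENNReal.ofReal p) ν) :
    Integrable (fun x => μ x * ‖g x‖ ^ p) ν := by
  refine (MemLp.integrable_norm_rpow_ofReal hp hg).bdd_mul hμ.aestronglyMeasurable (c := μ₂) ?_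
  filter_upwards [hμb] with x hx
  rw [Real.norm_eq_abs, abs_of_nonneg (by linarith [hx.1])]
  exact hx.2

/-- The energy inequality of one time step from `u` to `v`. -/
theorem energy_step {Ω : Set Plane} (hΩ : IsOpen Ω) (hb : Bornology.IsBounded Ω) {p : ℝ}
    (hp : 2.8 ≤ p) {μ : Plane → ℝ} {μ₁ μ₂ : ℝ} (hμ : AEMeasurable μ (volume.restrict Ω))
    (hμ₁ : 0 < μ₁) (hμb : ∀ x ∈ closure Ω, μ₁ ≤ μ x ∧ μ x ≤ μ₂) {l κ : ℝ} (hl : 0 < l)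
    (hκ : 0 < κ) {u v : Plane → ℝ} (hu : MemW10 Ω p u) (hv : MemW10 Ω p v) (f : closure Ω →ᵇ ℝ)
    (heq : ∀ w : Plane → ℝ, MemW10 Ω p w →
      1 / l * (∫ x in Ω, (oddPow (alpha p - 2) (v x) - oddPow (alpha p - 2) (u x)) * w x)
        + (∫ x in Ω, μ x * (‖weakGradient Ω v x‖ ^ (p - 2) *
            inner ℝ (weakGradient Ω v x) (weakGradient Ω w x)))
        - 1 / κ * (∫ x in Ω, negPart (v x) * w x)
      = ∫ x in Ω, extendZero f x * w x) :
    (alpha p - 1) / l * (∫ x in Ω, (oddPow ((alpha p - 2) / 2) (v x)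
        - oddPow ((alpha p - 2) / 2) (u x)) ^ 2)
      + ((∫ x in Ω, μ x * ‖weakGradient Ω v x‖ ^ p) -
          ∫ x in Ω, μ x * ‖weakGradient Ω u x‖ ^ p) / p
      + ((∫ x in Ω, negPart (v x) ^ 2) - ∫ x in Ω, negPart (u x) ^ 2) / (2 * κ)
      ≤ (∫ x in Ω, extendZero f x * v x) - ∫ x in Ω, extendZero f x * u x := by
  have := isFiniteMeasure_restrict_of_isBounded hb
  have hp0 : 0 < p := by linarith
  have hp2 : 2 ≤ p := by linarith
  have h1 := one_lt_alpha hp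
  have h2 := alpha_le hp
  have hw := hv.sub hΩ (by linarith) hu
  have hμae := ae_bounds hΩ hμb
  have hp1 : 1 ≤ ENNReal.ofReal p := by rw [ENNReal.one_le_ofReal]; linarith
  have gu := hu.1.memLp_weakGradient hΩ
  have gv := hv.1.memLp_weakGradient hΩ
  -- The equation is tested with the increment `v - u`.
  have E := heq _ hw
  have eF : ∫ x in Ω, extendZero f x * (v x - u x) =
      (∫ x in Ω, extendZero f x * v x) - ∫ x in Ω, extendZero f x * u x := by
    simp only [mul_sub]
    exact integral_sub (integrable_extendZero_mul f (hv.1.1.integrable hp1))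
      (integrable_extendZero_mul f (hu.1.1.integrable hp1))
  have eB : (alpha p - 1) * (∫ x in Ω, (oddPow ((alpha p - 2) / 2) (v x)
        - oddPow ((alpha p - 2) / 2) (u x)) ^ 2) ≤
      ∫ x in Ω, (oddPow (alpha p - 2) (v x) - oddPow (alpha p - 2) (u x)) * (v x - u x) := by
    rw [← integral_const_mul]
    -- Since the left integrand is nonnegative, only the right one has to be shown integrable.
    refine integral_mono_of_nonneg
      (ae_of_all _ fun x => mul_nonneg (by linarith) (sq_nonneg _)) ?_
      (ae_of_all _ fun x => oddPow_sub_sq_le h1 h2 (u x) (v x))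
    simp only [sub_mul]
    exact (integrable_oddPow_mul (by linarith) (by linarith) hv.1.1 hw.1.1).sub
      (integrable_oddPow_mul (by linarith) (by linarith) hu.1.1 hw.1.1)
  have eH : ((∫ x in Ω, μ x * ‖weakGradient Ω v x‖ ^ p) -
        ∫ x in Ω, μ x * ‖weakGradient Ω u x‖ ^ p) / p ≤
      ∫ x in Ω, μ x * (‖weakGradient Ω v x‖ ^ (p - 2) *
        inner ℝ (weakGradient Ω v x) (weakGradient Ω (fun x => v x - u x) x)) := by
    rw [← integral_sub (integrable_mul_norm_rpow hp0 hμ₁ hμ hμae gv)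
      (integrable_mul_norm_rpow hp0 hμ₁ hμ hμae gu), ← integral_div]
    refine integral_mono_ae (((integrable_mul_norm_rpow hp0 hμ₁ hμ hμae gv).sub
      (integrable_mul_norm_rpow hp0 hμ₁ hμ hμae gu)).div_const p)
      (integrable_flux hp2 hμ (hμae.mono fun x hx => ⟨by linarith [hx.1], hx.2⟩) gv
        (hw.1.memLp_weakGradient hΩ)) ?_
    filter_upwards [hv.1.weakGradient_sub hΩ hu.1, hμae] with x hx hμx
    rw [hx, ← mul_sub, mul_div_assoc]
    exact mul_le_mul_of_nonneg_left (rpow_norm_sub_le_inner hp2 _ _) (by linarith [hμx.1])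
  have eP : ∫ x in Ω, negPart (v x) * (v x - u x) ≤
      ((∫ x in Ω, negPart (u x) ^ 2) - ∫ x in Ω, negPart (v x) ^ 2) / 2 := by
    rw [← integral_sub (integrable_negPart_sq hp2 hu.1.1) (integrable_negPart_sq hp2 hv.1.1),
      ← integral_div]
    refine integral_mono (integrable_negPart_mul hp2 hv.1.1 hw.1.1)
      (((integrable_negPart_sq hp2 hu.1.1).sub (integrable_negPart_sq hp2 hv.1.1)).div_const 2)
      fun x => ?_
    have := negPart_mul_sub_le (v x) (u x)
    dsimp only
    linarith
  have eB' := mul_le_mul_of_nonneg_left eB (by positivity : 0 ≤ 1 / l)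
  have eP' := mul_le_mul_of_nonneg_left eP (by positivity : 0 ≤ 1 / κ)
  have r1 : ∀ b : ℝ, (alpha p - 1) / l * b = 1 / l * ((alpha p - 1) * b) := fun b => by ring
  have r2 : ∀ b c : ℝ, (b - c) / (2 * κ) = -(1 / κ * ((c - b) / 2)) := fun b c => by
    field_simp; ring
  rw [r1, r2, ← eF]
  linarith

/-! ### Uniform bounds -/

/-- Abel summation, with `X n k` in the role of the pairing of the `n`-th source average with the
`k`-th iterate. -/
theorem sum_sub_eq_sub_sum (X : ℕ → ℕ → ℝ) (m : ℕ) :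
    ∑ n ∈ Finset.range (m + 1), (X n (n + 1) - X n n) =
      X m (m + 1) - X 0 0 - ∑ n ∈ Finset.range m, (X (n + 1) (n + 1) - X n (n + 1)) := by
  induction m with
  | zero => simp
  | succ m ih => rw [Finset.sum_range_succ, ih, Finset.sum_range_succ _ m]; ring

/-- Summation by parts. -/
theorem sum_sub_le_of_bounded_variation {X : ℕ → ℕ → ℝ} {d : ℕ → ℝ} {K Y : ℝ} {N : ℕ}
    (hK : 0 ≤ K) (hY : 0 ≤ Y) (hX : ∀ n < N, ∀ k ≤ N, |X n k| ≤ K * Y) (hd0 : ∀ n, 0 ≤ d n)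
    (hd : ∀ n < N - 1, |X (n + 1) (n + 1) - X n (n + 1)| ≤ d n * Y)
    (hdK : ∑ n ∈ Finset.range (N - 1), d n ≤ K) (m : ℕ) (hm : m ≤ N) :
    ∑ n ∈ Finset.range m, (X n (n + 1) - X n n) ≤ 3 * K * Y := by
  rcases m with _ | m
  · simp; positivity
  rw [sum_sub_eq_sub_sum]
  -- The factor 3 counts the two boundary terms and the total variation, each at most `K * Y`.
  have h1 := (abs_le.1 (hX m (by omega) (m + 1) hm)).2
  have h2 := (abs_le.1 (hX 0 (by omega) 0 (by omega))).1
  have h3 : -∑ n ∈ Finset.range m, (X (n + 1) (n + 1) - X n (n + 1)) ≤ K * Y := by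
    rw [← Finset.sum_neg_distrib]
    calc _ ≤ ∑ n ∈ Finset.range m, d n * Y := by
          refine Finset.sum_le_sum fun n hn => ?_
          rw [Finset.mem_range] at hn
          linarith [(abs_le.1 (hd n (by omega))).1]
      _ ≤ ∑ n ∈ Finset.range (N - 1), d n * Y := by
          refine Finset.sum_le_sum_of_subset_of_nonneg ?_ fun n _ _ => mul_nonneg (hd0 n) hY
          exact Finset.range_subset_range.2 (by omega)
      _ ≤ K * Y := by rw [← Finset.sum_mul]; gcongr
  linarith

/-- The energy inequality summed over the first `m` time steps. -/
theorem energy_sum {Ω : Set Plane} (hΩ : IsOpen Ω) (hb : Bornology.IsBounded Ω) {T p : ℝ}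
    (hT : 0 < T) (hp : 2.8 ≤ p) {μ : Plane → ℝ} {μ₁ μ₂ : ℝ}
    (hμ : AEMeasurable μ (volume.restrict Ω)) (hμ₁ : 0 < μ₁)
    (hμb : ∀ x ∈ closure Ω, μ₁ ≤ μ x ∧ μ x ≤ μ₂) {a : ℝ → closure Ω →ᵇ ℝ} {u₀ : Plane → ℝ}
    (hu₀ : ∀ᵐ x ∂(volume.restrict Ω), 0 ≤ u₀ x) {κ : ℝ} (hκ : 0 < κ) {N : ℕ} (hN : 1 ≤ N)
    {u : ℕ → Plane → ℝ} (hu : IsSemiDiscreteSolution Ω p T μ a u₀ κ N u) {A : ℕ → closure Ω →ᵇ ℝ}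
    (hA : ∀ n, A n = (1 / step T N) • ∫ t in (n * step T N)..((n + 1) * step T N), a t)
    {m : ℕ} (hm : m ≤ N) :
    (alpha p - 1) / step T N * (∑ n ∈ Finset.range m, ∫ x in Ω,
        (oddPow ((alpha p - 2) / 2) (u (n + 1) x) - oddPow ((alpha p - 2) / 2) (u n x)) ^ 2)
      + ((∫ x in Ω, μ x * ‖weakGradient Ω (u m) x‖ ^ p) -
          ∫ x in Ω, μ x * ‖weakGradient Ω (u 0) x‖ ^ p) / p
      ≤ ∑ n ∈ Finset.range m, ((∫ x in Ω, extendZero (A n) x * u (n + 1) x) -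
          ∫ x in Ω, extendZero (A n) x * u n x) := by
  obtain ⟨h0, hW, hS⟩ := hu
  have hl : 0 < step T N := div_pos hT (by exact_mod_cast hN)
  have hsum := Finset.sum_le_sum fun n (hn : n ∈ Finset.range m) =>
    have hn' : n < m := Finset.mem_range.1 hn
    energy_step hΩ hb hp hμ hμ₁ hμb hl hκ (hW n (by omega)) (hW (n + 1) (by omega)) (A n)
      (by rw [hA]; exact hS n (by omega))
  rw [Finset.sum_add_distrib, Finset.sum_add_distrib, ← Finset.mul_sum, ← Finset.sum_div,
    ← Finset.sum_div, Finset.sum_range_sub (fun n => ∫ x in Ω, μ x * ‖weakGradient Ω (u n) x‖ ^ p),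
    Finset.sum_range_sub (fun n => ∫ x in Ω, negPart (u n x) ^ 2)] at hsum
  -- The penalty energy starts at zero because the initial datum is nonnegative; otherwise a term of
  -- order `1 / κ` would remain.
  have hP0 : ∫ x in Ω, negPart (u 0 x) ^ 2 = 0 := by
    refine integral_eq_zero_of_ae ?_
    filter_upwards [h0, hu₀] with x hx hx0
    rw [hx, negPart_of_nonneg hx0]; simp
  have hPm : 0 ≤ ∫ x in Ω, negPart (u m x) ^ 2 := integral_nonneg fun x => sq_nonneg _
  have : 0 ≤ ((∫ x in Ω, negPart (u m x) ^ 2) - ∫ x in Ω, negPart (u 0 x) ^ 2) / (2 * κ) := by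
    rw [hP0, sub_zero]; positivity
  linarith

/-- The energy inequality is closed here by absorption: the source contributes at most `3KY`, and
`Y` is affine in the largest gradient integral `G`, with a slope that can be chosen small. -/
theorem exists_uniform_bound {Ω : Set Plane} (hΩ : IsOpen Ω) (hb : Bornology.IsBounded Ω)
    {T p : ℝ} (hT : 0 < T) (hp : 2.8 ≤ p) {μ : Plane → ℝ} {μ₁ μ₂ : ℝ}
    (hμ : AEMeasurable μ (volume.restrict Ω)) (hμ₁ : 0 < μ₁)
    (hμb : ∀ x ∈ closure Ω, μ₁ ≤ μ x ∧ μ x ≤ μ₂) {a : ℝ → closure Ω →ᵇ ℝ}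
    (ha : MemW1Time T p a) {u₀ : Plane → ℝ} (hu₀ : MemW10 Ω p u₀)
    (hu₀' : ∀ᵐ x ∂(volume.restrict Ω), 0 ≤ u₀ x) :
    ∃ M : ℝ, 0 < M ∧ ∀ κ : ℝ, 0 < κ → ∀ N : ℕ, 1 ≤ N → ∀ u : ℕ → Plane → ℝ,
      IsSemiDiscreteSolution Ω p T μ a u₀ κ N u →
      (∀ n ≤ N, ∫ x in Ω, ‖weakGradient Ω (u n) x‖ ^ p ≤ M) ∧
      (∀ n ≤ N, ∫ x in Ω, |u n x| ^ p ≤ M) ∧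
      1 / step T N * (∑ n ∈ Finset.range N, ∫ x in Ω,
        (oddPow ((alpha p - 2) / 2) (u (n + 1) x) - oddPow ((alpha p - 2) / 2) (u n x)) ^ 2) ≤ M ∧
      ∀ n < N,
        ‖(1 / step T N) • ∫ t in (n * step T N)..((n + 1) * step T N), a t‖ ≤ M := by
  have := isFiniteMeasure_restrict_of_isBounded hb
  have hp0 : 0 < p := by linarith
  have hα := one_lt_alpha hp
  have hp1 : 1 ≤ ENNReal.ofReal p := by rw [ENNReal.one_le_ofReal]; linarith
  obtain ⟨CP, hCP, hpoin⟩ := exists_poincare hΩ hb (by linarith : 2 ≤ p)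
  obtain ⟨K, hK, hav⟩ := ha.exists_bound_average hT (by linarith : 1 ≤ p)
  -- Chosen so that `3 * K * (ε * CP) = μ₁ / (2 * p)`, half of the coefficient `μ₁ / p` of `G` in
  -- the energy.
  set ε : ℝ := μ₁ / (6 * p * K * CP) with hε
  have hε0 : 0 < ε := by positivity
  set D : ℝ := (1 / ε) ^ (1 / (p - 1)) * volume.real Ω with hD
  have hD0 : 0 ≤ D := by positivity
  set H₀ : ℝ := ∫ x in Ω, μ x * ‖weakGradient Ω u₀ x‖ ^ p with hH₀
  have hH₀0 : 0 ≤ H₀ := integral_nonneg_of_ae (by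
    filter_upwards [ae_bounds hΩ hμb] with x hx
    have : 0 ≤ μ x := by linarith [hx.1]
    exact mul_nonneg this (by positivity))
  set M₀ : ℝ := 2 * p / μ₁ * (H₀ / p + 3 * K * D) with hM₀
  have hM₀0 : 0 ≤ M₀ := by positivity
  -- The energy inequality at `m = N`, with `G` replaced by its bound `M₀`, divided by `α - 1`.
  set M₁ : ℝ := (H₀ / p + 3 * K * (ε * CP * M₀ + D)) / (alpha p - 1) with hM₁
  have hM₁0 : 0 ≤ M₁ := div_nonneg (by positivity) (by linarith)
  refine ⟨M₀ + CP * M₀ + M₁ + K, by positivity, fun κ hκ N hN u hu => ?_⟩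
  obtain ⟨A, hA⟩ : ∃ A : ℕ → closure Ω →ᵇ ℝ, ∀ n, A n =
      (1 / step T N) • ∫ t in (n * step T N)..((n + 1) * step T N), a t := ⟨_, fun _ => rfl⟩
  obtain ⟨hAK, hAV⟩ := hav N hN A hA
  have hl : 0 < step T N := div_pos hT (by exact_mod_cast hN)
  have hW := hu.2.1
  -- The initial iterate equals `u₀` only almost everywhere, so uniqueness of weak gradients is
  -- needed.
  have hH0 : ∫ x in Ω, μ x * ‖weakGradient Ω (u 0) x‖ ^ p = H₀ := by
    refine integral_congr_ae ?_
    filter_upwards [(hW 0 (by omega)).1.hasWeakGradient.ae_eq hΩ hu₀.1.hasWeakGradient hu.1]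
      with x hx
    rw [hx]
  have hint : ∀ n ≤ N, Integrable (u n) (volume.restrict Ω) := fun n hn =>
    (hW n hn).1.1.integrable hp1
  have hL1 : ∀ n ≤ N, ∫ x in Ω, |u n x| ≤
      ε * CP * (∫ x in Ω, ‖weakGradient Ω (u n) x‖ ^ p) + D := by
    intro n hn
    have h1 : ∫ x in Ω, |u n x| ≤ ∫ x in Ω, (ε * |u n x| ^ p + (1 / ε) ^ (1 / (p - 1))) :=
      integral_mono (hint n hn).abs
        (((MemLp.integrable_abs_rpow hp0 (hW n hn).1.1).const_mul ε).add (integrable_const _))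
        fun x => le_mul_rpow_add (abs_nonneg _) (by linarith) hε0
    rw [integral_add ((MemLp.integrable_abs_rpow hp0 (hW n hn).1.1).const_mul ε)
      (integrable_const _), integral_const_mul, integral_const, smul_eq_mul,
      measureReal_restrict_apply_univ, mul_comm (volume.real Ω)] at h1
    have h2 := mul_le_mul_of_nonneg_left (hpoin _ (hW n hn)) hε0.le
    linarith
  have hHG : ∀ n ≤ N, μ₁ * (∫ x in Ω, ‖weakGradient Ω (u n) x‖ ^ p) ≤
      ∫ x in Ω, μ x * ‖weakGradient Ω (u n) x‖ ^ p := by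
    intro n hn
    have hg := (hW n hn).1.memLp_weakGradient hΩ
    rw [← integral_const_mul]
    refine integral_mono_ae ((MemLp.integrable_norm_rpow_ofReal hp0 hg).const_mul _)
      (integrable_mul_norm_rpow hp0 hμ₁ hμ (ae_bounds hΩ hμb) hg) ?_
    filter_upwards [ae_bounds hΩ hμb] with x hx
    exact mul_le_mul_of_nonneg_right hx.1 (by positivity)
  -- The inequality will be stopped at the index of largest gradient integral, so that the same `G`
  -- appears on both sides.
  obtain ⟨k, hk, hmax⟩ := Finset.exists_max_image (Finset.range (N + 1))
    (fun n => ∫ x in Ω, ‖weakGradient Ω (u n) x‖ ^ p) ⟨0, by simp⟩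
  have hkN : k ≤ N := by rw [Finset.mem_range] at hk; omega
  set G : ℝ := ∫ x in Ω, ‖weakGradient Ω (u k) x‖ ^ p with hG
  have hG0 : 0 ≤ G := integral_nonneg fun x => by positivity
  have hGn : ∀ n ≤ N, ∫ x in Ω, ‖weakGradient Ω (u n) x‖ ^ p ≤ G := fun n hn =>
    hmax n (by rw [Finset.mem_range]; omega)
  set Y : ℝ := ε * CP * G + D with hY
  have hY0 : 0 ≤ Y := by positivity
  have hLY : ∀ n ≤ N, ∫ x in Ω, |u n x| ≤ Y := fun n hn =>
    (hL1 n hn).trans (by rw [hY]; gcongr; exact hGn n hn)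
  have hF : ∀ m ≤ N, ∑ n ∈ Finset.range m, ((∫ x in Ω, extendZero (A n) x * u (n + 1) x) -
      ∫ x in Ω, extendZero (A n) x * u n x) ≤ 3 * K * Y := by
    refine sum_sub_le_of_bounded_variation (X := fun n k => ∫ x in Ω, extendZero (A n) x * u k x)
      (d := fun n => ‖A (n + 1) - A n‖) hK.le hY0 (fun n hn k hk => ?_) (fun n => norm_nonneg _)
      (fun n hn => ?_) hAV
    · refine (abs_integral_extendZero_mul_le (A n) (hint k hk)).trans ?_
      exact mul_le_mul (hAK n hn) (hLY k hk) (integral_nonneg fun x => abs_nonneg _) hK.le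
    · have hn1 : n + 1 ≤ N := by omega
      rw [← integral_sub (integrable_extendZero_mul _ (hint _ hn1))
        (integrable_extendZero_mul _ (hint _ hn1))]
      simp only [← sub_mul, ← extendZero_sub]
      refine (abs_integral_extendZero_mul_le _ (hint _ hn1)).trans ?_
      exact mul_le_mul_of_nonneg_left (hLY _ hn1) (norm_nonneg _)
  have hE := fun m (hm : m ≤ N) => (energy_sum hΩ hb hT hp hμ hμ₁ hμb hu₀' hκ hN hu hA hm).trans
    (hF m hm)
  rw [hH0] at hE
  have hBnn : ∀ m, 0 ≤ ∑ n ∈ Finset.range m, ∫ x in Ω, (oddPow ((alpha p - 2) / 2) (u (n + 1) x)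
      - oddPow ((alpha p - 2) / 2) (u n x)) ^ 2 := fun m =>
    Finset.sum_nonneg fun n _ => integral_nonneg fun x => sq_nonneg _
  have hGM : G ≤ M₀ := by
    have h1 := hE k hkN
    have h2 : 0 ≤ (alpha p - 1) / step T N * ∑ n ∈ Finset.range k, ∫ x in Ω,
        (oddPow ((alpha p - 2) / 2) (u (n + 1) x) - oddPow ((alpha p - 2) / 2) (u n x)) ^ 2 :=
      mul_nonneg (div_nonneg (by linarith) hl.le) (hBnn k)
    have h3 := div_le_div_of_nonneg_right (hHG k hkN) hp0.le
    rw [sub_div _ H₀] at h1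
    have h4 : 3 * K * Y = μ₁ / (2 * p) * G + 3 * K * D := by
      rw [hY, hε]; field_simp; ring
    have h5 : μ₁ / (2 * p) * G ≤ H₀ / p + 3 * K * D := by
      have : μ₁ * G / p = μ₁ / (2 * p) * G + μ₁ / (2 * p) * G := by field_simp; ring
      linarith
    calc G = 2 * p / μ₁ * (μ₁ / (2 * p) * G) := by field_simp
      _ ≤ M₀ := by rw [hM₀]; gcongr
  refine ⟨fun n hn => ?_, fun n hn => ?_, ?_, fun n hn => ?_⟩
  · have := (hGn n hn).trans hGM
    have : 0 ≤ CP * M₀ := by positivity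
    linarith
  · have h1 := (hpoin _ (hW n hn)).trans
      (mul_le_mul_of_nonneg_left ((hGn n hn).trans hGM) hCP.le)
    linarith
  · have h1 := hE N le_rfl
    have h2 : 0 ≤ ∫ x in Ω, μ x * ‖weakGradient Ω (u N) x‖ ^ p :=
      le_trans (mul_nonneg hμ₁.le (integral_nonneg fun x => by positivity)) (hHG N le_rfl)
    have h3 : 3 * K * Y ≤ 3 * K * (ε * CP * M₀ + D) := by rw [hY]; gcongr
    rw [sub_div _ H₀] at h1
    have h4 := div_nonneg h2 hp0.le
    have h5 : 1 / step T N * (∑ n ∈ Finset.range N, ∫ x in Ω,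
        (oddPow ((alpha p - 2) / 2) (u (n + 1) x) - oddPow ((alpha p - 2) / 2) (u n x)) ^ 2) ≤
        M₁ := by
      rw [hM₁, le_div_iff₀ (by linarith)]
      refine le_trans (le_of_eq ?_) (by linarith : (alpha p - 1) / step T N *
        (∑ n ∈ Finset.range N, ∫ x in Ω, (oddPow ((alpha p - 2) / 2) (u (n + 1) x)
          - oddPow ((alpha p - 2) / 2) (u n x)) ^ 2) ≤ _)
      ring
    have : 0 ≤ CP * M₀ := by positivity
    linarith
  · have h1 := hAK n hn
    rw [hA] at h1
    have : 0 ≤ CP * M₀ := by positivity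
    linarith

/-! ### From bounds on integrals to bounds on norms -/

/-- The integral of `|f|^q` is at most `volume.real Ω + M`. The extra 1 makes the base at least 1,
so the root of order `q ≥ 1` can be dropped. -/
theorem memLp_and_eLpNorm_le {Ω : Set Plane} (hb : Bornology.IsBounded Ω) {p q M : ℝ}
    (hp : 0 < p) (hq : 1 ≤ q) {u f : Plane → ℝ}
    (hu : MemLp u (ENNReal.ofReal p) (volume.restrict Ω)) (hM0 : 0 ≤ M)
    (hM : ∫ x in Ω, |u x| ^ p ≤ M) (hf : AEStronglyMeasurable f (volume.restrict Ω))
    (hfu : ∀ x, |f x| ^ q ≤ 1 + |u x| ^ p) :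
    MemLp f (ENNReal.ofReal q) (volume.restrict Ω) ∧
      eLpNorm f (ENNReal.ofReal q) (volume.restrict Ω) ≤
        ENNReal.ofReal (1 + volume.real Ω + M) := by
  have := isFiniteMeasure_restrict_of_isBounded hb
  have hq0 : 0 < q := by linarith
  have hi := MemLp.integrable_abs_rpow hp hu
  have hfi : Integrable (fun x => ‖f x‖ ^ q) (volume.restrict Ω) := by
    refine ((integrable_const 1).add hi).mono' (hf.norm.aemeasurable.pow_const q).aestronglyMeasurable
      (ae_of_all _ fun x => ?_)
    rw [Real.norm_of_nonneg (by positivity)]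
    exact hfu x
  have hm : MemLp f (ENNReal.ofReal q) (volume.restrict Ω) := by
    rw [← integrable_norm_rpow_iff hf (by simpa using hq0) (by simp), ENNReal.toReal_ofReal hq0.le]
    exact hfi
  refine ⟨hm, ?_⟩
  rw [eLpNorm_ofReal_eq hq0 hm]
  refine ENNReal.ofReal_le_ofReal ?_
  have h1 : ∫ x in Ω, ‖f x‖ ^ q ≤ ∫ x in Ω, (1 + |u x| ^ p) :=
    integral_mono hfi ((integrable_const 1).add hi) hfu
  rw [integral_add (integrable_const 1) hi, integral_const, smul_eq_mul, mul_one,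
    measureReal_restrict_apply_univ] at h1
  have h0 : 0 ≤ volume.real Ω := measureReal_nonneg
  calc (∫ x in Ω, ‖f x‖ ^ q) ^ (1 / q) ≤ (1 + volume.real Ω + M) ^ (1 / q) := by
        gcongr
        linarith
    _ ≤ (1 + volume.real Ω + M) ^ (1 : ℝ) := by
        refine Real.rpow_le_rpow_of_exponent_le (by linarith) ?_
        rw [div_le_one hq0]; exact hq
    _ = _ := Real.rpow_one _

theorem w1Norm_rpow_le {Ω : Set Plane} (hΩ : IsOpen Ω) {p M : ℝ} (hp : 0 < p) {u : Plane → ℝ}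
    (hu : MemW1 Ω p u) (h1 : ∫ x in Ω, |u x| ^ p ≤ M)
    (h2 : ∫ x in Ω, ‖weakGradient Ω u x‖ ^ p ≤ M) :
    w1Norm Ω p u ^ p ≤ ENNReal.ofReal (2 * M) := by
  rw [w1Norm_rpow_eq hΩ hp hu]
  exact ENNReal.ofReal_le_ofReal (by linarith)

theorem w1Norm_le {Ω : Set Plane} (hΩ : IsOpen Ω) {p M : ℝ} (hp : 1 ≤ p) (hM : 0 ≤ M)
    {u : Plane → ℝ} (hu : MemW1 Ω p u) (h1 : ∫ x in Ω, |u x| ^ p ≤ M)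
    (h2 : ∫ x in Ω, ‖weakGradient Ω u x‖ ^ p ≤ M) :
    w1Norm Ω p u ≤ ENNReal.ofReal (1 + 2 * M) := by
  rw [← ENNReal.rpow_le_rpow_iff (by linarith : 0 < p),
    ENNReal.ofReal_rpow_of_nonneg (by linarith) (by linarith)]
  refine (w1Norm_rpow_le hΩ (by linarith) hu h1 h2).trans (ENNReal.ofReal_le_ofReal ?_)
  have := Real.rpow_le_rpow_of_exponent_le (by linarith : 1 ≤ 1 + 2 * M) hp
  rw [Real.rpow_one] at this
  linarith

theorem integrals_le_one_of_w1Norm_le_one {Ω : Set Plane} (hΩ : IsOpen Ω) {p : ℝ} (hp : 0 < p)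
    {v : Plane → ℝ} (hv : MemW1 Ω p v) (h : w1Norm Ω p v ≤ 1) :
    ∫ x in Ω, |v x| ^ p ≤ 1 ∧ ∫ x in Ω, ‖weakGradient Ω v x‖ ^ p ≤ 1 := by
  have h1 := ENNReal.rpow_le_rpow h hp.le
  rw [w1Norm_rpow_eq hΩ hp hv, ENNReal.one_rpow, ENNReal.ofReal_le_one] at h1
  have h2 : 0 ≤ ∫ x in Ω, |v x| ^ p := integral_nonneg fun x => by positivity
  have h3 : 0 ≤ ∫ x in Ω, ‖weakGradient Ω v x‖ ^ p := integral_nonneg fun x => by positivity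
  constructor <;> linarith

/-- The bound of the discrete time derivative in the dual norm. -/
theorem dualNorm_le {Ω : Set Plane} (hΩ : IsOpen Ω) (hb : Bornology.IsBounded Ω) {p : ℝ}
    (hp : 2 ≤ p) {μ : Plane → ℝ} {μ₁ μ₂ : ℝ}
    (hμ₁ : 0 < μ₁) (hμb : ∀ x ∈ closure Ω, μ₁ ≤ μ x ∧ μ x ≤ μ₂) (hμ₂ : 0 < μ₂) {l κ M : ℝ}
    (hκ : 0 < κ) {u v : Plane → ℝ} (hv : MemW10 Ω p v) (f : closure Ω →ᵇ ℝ)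
    (heq : ∀ w : Plane → ℝ, MemW10 Ω p w →
      1 / l * (∫ x in Ω, (oddPow (alpha p - 2) (v x) - oddPow (alpha p - 2) (u x)) * w x)
        + (∫ x in Ω, μ x * (‖weakGradient Ω v x‖ ^ (p - 2) *
            inner ℝ (weakGradient Ω v x) (weakGradient Ω w x)))
        - 1 / κ * (∫ x in Ω, negPart (v x) * w x)
      = ∫ x in Ω, extendZero f x * w x)
    (hf : ‖f‖ ≤ M) (h1 : ∫ x in Ω, |v x| ^ p ≤ M)
    (h2 : ∫ x in Ω, ‖weakGradient Ω v x‖ ^ p ≤ M) :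
    dualNorm Ω p (fun x => (oddPow (alpha p - 2) (v x) - oddPow (alpha p - 2) (u x)) / l) ≤
      ENNReal.ofReal ((M * (volume.real Ω + 1) + μ₂ * (M + 1) + (2 * volume.real Ω + M + 1)) *
        (1 + 1 / κ)) := by
  have := isFiniteMeasure_restrict_of_isBounded hb
  have hp0 : 0 < p := by linarith
  have hp1 : 1 ≤ ENNReal.ofReal p := by rw [ENNReal.one_le_ofReal]; linarith
  have hM0 : 0 ≤ M := (norm_nonneg f).trans hf
  have hV0 : 0 ≤ volume.real Ω := measureReal_nonneg
  refine iSup_le fun w => iSup_le fun hw => iSup_le fun hw1 => ?_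
  obtain ⟨a1, a2⟩ := integrals_le_one_of_w1Norm_le_one hΩ hp0 hw.1 hw1
  have iw := MemLp.integrable_abs_rpow hp0 hw.1.1
  have iv := MemLp.integrable_abs_rpow hp0 hv.1.1
  have gw := MemLp.integrable_norm_rpow_ofReal hp0 (hw.1.memLp_weakGradient hΩ)
  have gv := MemLp.integrable_norm_rpow_ofReal hp0 (hv.1.memLp_weakGradient hΩ)
  -- The equation expresses the difference quotient through source, flux and penalty, each of which
  -- is bounded on the unit ball of test functions.
  have E := heq w hw
  have e1 : |∫ x in Ω, extendZero f x * w x| ≤ M * (volume.real Ω + 1) := by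
    refine (abs_integral_extendZero_mul_le f (hw.1.1.integrable hp1)).trans ?_
    have : ∫ x in Ω, |w x| ≤ ∫ x in Ω, (1 + |w x| ^ p) :=
      integral_mono (hw.1.1.integrable hp1).abs ((integrable_const 1).add iw) fun x => by
        have := rpow_le_one_add_rpow (abs_nonneg (w x)) zero_le_one (by linarith : 1 ≤ p)
        rwa [Real.rpow_one] at this
    rw [integral_add (integrable_const 1) iw, integral_const, smul_eq_mul, mul_one,
      measureReal_restrict_apply_univ] at this
    exact mul_le_mul hf (by linarith) (integral_nonneg fun x => abs_nonneg _) hM0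
  have e2 : |∫ x in Ω, μ x * (‖weakGradient Ω v x‖ ^ (p - 2) *
      inner ℝ (weakGradient Ω v x) (weakGradient Ω w x))| ≤ μ₂ * (M + 1) := by
    rw [← Real.norm_eq_abs]
    refine (norm_integral_le_of_norm_le ((gv.add gw).const_mul μ₂) ?_).trans ?_
    · filter_upwards [ae_bounds hΩ hμb] with x hx
      exact abs_flux_le hp (by linarith [hx.1]) hx.2 _ _
    · simp only [Pi.add_apply]
      rw [integral_const_mul, integral_add gv gw]
      gcongr
  have e3 : |∫ x in Ω, negPart (v x) * w x| ≤ 2 * volume.real Ω + M + 1 := by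
    rw [← Real.norm_eq_abs]
    refine (norm_integral_le_of_norm_le (integrable_two_add_add hp0 hv.1.1 hw.1.1)
      (ae_of_all _ fun x => abs_negPart_mul_le hp _ _)).trans ?_
    have i2 : Integrable (fun x => 2 + |v x| ^ p) (volume.restrict Ω) := (integrable_const 2).add iv
    rw [integral_add i2 iw, integral_add (integrable_const 2) iv, integral_const, smul_eq_mul,
      measureReal_restrict_apply_univ]
    linarith
  have e4 : ∫ x in Ω, (oddPow (alpha p - 2) (v x) - oddPow (alpha p - 2) (u x)) / l * w x =
      1 / l * ∫ x in Ω, (oddPow (alpha p - 2) (v x) - oddPow (alpha p - 2) (u x)) * w x := by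
    rw [← integral_const_mul]
    congr 1
    ext x; ring
  rw [Real.enorm_eq_ofReal_abs]
  refine ENNReal.ofReal_le_ofReal ?_
  have hk : 0 ≤ 1 / κ := by positivity
  have e5 : |1 / κ * ∫ x in Ω, negPart (v x) * w x| ≤ 1 / κ * (2 * volume.real Ω + M + 1) := by
    rw [abs_mul, abs_of_nonneg hk]; gcongr
  rw [e4]
  rw [abs_le] at e1 e2 e5 ⊢
  -- Only the penalty carries `1 / κ`; this nonnegative term pads the other two bounds to the common
  -- factor `1 + 1 / κ`.
  have h6 : 0 ≤ 1 / κ * (M * (volume.real Ω + 1) + μ₂ * (M + 1)) := by positivity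
  constructor <;> linarith [e1.1, e1.2, e2.1, e2.2, e5.1, e5.2]

theorem eLpNorm_two_sq {ν : Measure Plane} {f : Plane → ℝ} (hf : MemLp f 2 ν) :
    eLpNorm f 2 ν ^ 2 = ENNReal.ofReal (∫ x, f x ^ 2 ∂ν) := by
  have key := eLpNorm_ofReal_rpow_eq (p := 2) two_pos (by simpa using hf : MemLp f _ ν)
  simpa using key

/-- The weight `l` against the squared quotient `1 / l²` leaves the factor `1 / l` of the energy
inequality. -/
theorem sum_eLpNorm_div_sq {ν : Measure Plane} {l : ℝ} (hl : 0 < l) (N : ℕ) {f : ℕ → Plane → ℝ}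
    (hf : ∀ n < N, MemLp (f n) 2 ν) :
    ENNReal.ofReal l * ∑ n ∈ Finset.range N, eLpNorm (fun x => f n x / l) 2 ν ^ 2 =
      ENNReal.ofReal (1 / l * ∑ n ∈ Finset.range N, ∫ x, f n x ^ 2 ∂ν) := by
  have h : ∀ n ∈ Finset.range N, eLpNorm (fun x => f n x / l) 2 ν ^ 2 =
      ENNReal.ofReal (1 / l ^ 2 * ∫ x, f n x ^ 2 ∂ν) := by
    intro n hn
    have hm : MemLp (fun x => f n x / l) 2 ν := by
      simpa only [div_eq_mul_inv] using (hf n (Finset.mem_range.1 hn)).mul_const l⁻¹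
    rw [eLpNorm_two_sq hm, ← integral_const_mul]
    congr 2
    ext x; field_simp
  rw [Finset.sum_congr rfl h, ← ENNReal.ofReal_sum_of_nonneg, ← ENNReal.ofReal_mul hl.le,
    ← Finset.mul_sum]
  · congr 1; field_simp
  · exact fun n _ => mul_nonneg (by positivity) (integral_nonneg fun x => sq_nonneg _)

end IceSheet

end

theorem mainTheorem3
    (Ω : Set IceSheet.Plane) (hΩ : IceSheet.IsLipschitzDomain Ω)
    (T : ℝ) (hT : 0 < T) (p : ℝ) (hp : 2.8 ≤ p) (hp' : p ≤ 5)
    (μ : IceSheet.Plane → ℝ) (hμ : AEMeasurable μ (volume.restrict Ω))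
    (μ₁ μ₂ : ℝ) (hμ₁ : 0 < μ₁) (hμ₂ : 0 < μ₂) (hμb : ∀ x ∈ closure Ω, μ₁ ≤ μ x ∧ μ x ≤ μ₂)
    (a : ℝ → closure Ω →ᵇ ℝ) (ha : IceSheet.MemW1Time T p a)
    (u₀ : IceSheet.Plane → ℝ) (hu₀ : IceSheet.MemW10 Ω p u₀)
    (hu₀' : ∀ᵐ x ∂(volume.restrict Ω), 0 ≤ u₀ x)
    (C₁ : ℝ) (hC₁ : 0 < C₁) :
    ∃ C : ℝ, 0 < C ∧ ∀ κ : ℝ, 0 < κ → ∀ N : ℕ, 1 ≤ N → ∀ u : ℕ → IceSheet.Plane → ℝ,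
      IceSheet.IsSemiDiscreteSolution Ω p T μ a u₀ κ N u →
      1 / κ * (∑ n ∈ Finset.range N,
        ∫ x in Ω, IceSheet.negPart (u (n + 1) x) * (u (n + 1) x - u n x)) ≤ C₁ →
      (∀ n ≤ N, eLpNorm (u n) (ENNReal.ofReal (IceSheet.alpha p)) (volume.restrict Ω)
        ≤ ENNReal.ofReal C) ∧
      (ENNReal.ofReal (IceSheet.step T N) *
          ∑ n ∈ Finset.range (N + 1), IceSheet.w1Norm Ω p (u n) ^ p
        ≤ ENNReal.ofReal C) ∧
      (ENNReal.ofReal (IceSheet.step T N) *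
          ∑ n ∈ Finset.range N,
            eLpNorm (fun x =>
              (IceSheet.oddPow ((IceSheet.alpha p - 2) / 2) (u (n + 1) x)
                - IceSheet.oddPow ((IceSheet.alpha p - 2) / 2) (u n x)) / IceSheet.step T N)
              2 (volume.restrict Ω) ^ 2
        ≤ ENNReal.ofReal C) ∧
      (∀ n ≤ N, eLpNorm (fun x => IceSheet.oddPow ((IceSheet.alpha p - 2) / 2) (u n x))
          2 (volume.restrict Ω)
        ≤ ENNReal.ofReal C) ∧
      (∀ n ≤ N, IceSheet.w1Norm Ω p (u n) ≤ ENNReal.ofReal C) ∧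
      (∀ n < N, IceSheet.dualNorm Ω p (fun x =>
          (IceSheet.oddPow (IceSheet.alpha p - 2) (u (n + 1) x)
            - IceSheet.oddPow (IceSheet.alpha p - 2) (u n x)) / IceSheet.step T N)
        ≤ ENNReal.ofReal (C * (1 + 1 / κ))) ∧
      (∀ n ≤ N, eLpNorm (fun x => IceSheet.oddPow (IceSheet.alpha p - 2) (u n x))
          (ENNReal.ofReal (IceSheet.alpha p / (IceSheet.alpha p - 1))) (volume.restrict Ω)
        ≤ ENNReal.ofReal C) := by
  obtain ⟨hΩo, -, hb, -⟩ := hΩ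
  have hp0 : 0 < p := by linarith
  have h1 := IceSheet.one_lt_alpha hp
  have h2 := IceSheet.alpha_le hp
  obtain ⟨M, hM, hbound⟩ := IceSheet.exists_uniform_bound hΩo hb hT hp hμ hμ₁ hμb ha hu₀ hu₀'
  set V : ℝ := volume.real Ω with hV
  have hV0 : 0 ≤ V := measureReal_nonneg
  set R : ℝ := M * (V + 1) + μ₂ * (M + 1) + (2 * V + M + 1) with hR
  have hR0 : 0 < R := by positivity
  -- A sum of nonnegative constants, one for each type of estimate, so that each is below `C`.
  set C : ℝ := (1 + V + M) + 4 * T * M + R + (1 + 2 * M) with hC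
  have hTM : 0 < 4 * T * M := by positivity
  refine ⟨C, by positivity, fun κ hκ N hN u hu _ => ?_⟩
  obtain ⟨bG, bI, bB, bA⟩ := hbound κ hκ N hN u hu
  have hW := hu.2.1
  have hN0 : (1 : ℝ) ≤ N := by exact_mod_cast hN
  have hl : 0 < IceSheet.step T N := div_pos hT (by linarith)
  -- Used with `r = 2` for `q = (α-2)/2` and with `r = α/(α-1)` for `q = α-2`: in both cases the
  -- composite power is `|u|^α`, and `α ≤ p`.
  have hpow : ∀ q r : ℝ, -1 < q → 0 < r → (q + 1) * r = IceSheet.alpha p → ∀ n ≤ N,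
      ∀ x, |IceSheet.oddPow q (u n x)| ^ r ≤ 1 + |u n x| ^ p := by
    intro q r hq hr hqr n hn x
    rw [IceSheet.abs_oddPow hq, ← Real.rpow_mul (abs_nonneg _), hqr]
    exact IceSheet.rpow_le_one_add_rpow (abs_nonneg _) (by linarith) (by linarith)
  have hodd : ∀ q : ℝ, ∀ n ≤ N,
      AEStronglyMeasurable (fun x => IceSheet.oddPow q (u n x)) (volume.restrict Ω) :=
    fun q n hn => ((IceSheet.measurable_oddPow q).comp_aemeasurable
      (hW n hn).1.1.1.aemeasurable).aestronglyMeasurable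
  have hle : ENNReal.ofReal (1 + V + M) ≤ ENNReal.ofReal C :=
    ENNReal.ofReal_le_ofReal (by rw [hC]; linarith)
  have hβ := fun n (hn : n ≤ N) => IceSheet.memLp_and_eLpNorm_le hb hp0 one_le_two (hW n hn).1.1
    hM.le (bI n hn) (hodd ((IceSheet.alpha p - 2) / 2) n hn)
    (hpow _ 2 (by linarith) two_pos (by ring) n hn)
  rw [ENNReal.ofReal_ofNat] at hβ
  refine ⟨fun n hn => ?_, ?_, ?_, fun n hn => (hβ n hn).2.trans hle, fun n hn => ?_, fun n hn => ?_,
    fun n hn => ?_⟩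
  · exact (IceSheet.memLp_and_eLpNorm_le hb hp0 h1.le (hW n hn).1.1 hM.le (bI n hn)
      (hW n hn).1.1.1 fun x => IceSheet.rpow_le_one_add_rpow (abs_nonneg _) (by linarith)
        (by linarith)).2.trans hle
  · have hs : ∑ n ∈ Finset.range (N + 1), IceSheet.w1Norm Ω p (u n) ^ p ≤
        ∑ _n ∈ Finset.range (N + 1), ENNReal.ofReal (2 * M) :=
      Finset.sum_le_sum fun n hn =>
        have hn' : n ≤ N := by rw [Finset.mem_range] at hn; omega
        IceSheet.w1Norm_rpow_le hΩo hp0 (hW n hn').1 (bI n hn') (bG n hn')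
    refine (mul_le_mul_right hs _).trans ?_
    rw [← ENNReal.ofReal_sum_of_nonneg fun _ _ => by positivity, ← ENNReal.ofReal_mul hl.le,
      Finset.sum_const, Finset.card_range, nsmul_eq_mul]
    refine ENNReal.ofReal_le_ofReal ?_
    -- The sum has `N + 1` terms, and `T (N + 1) / N ≤ 2T` because `N ≥ 1`.
    have hlT : IceSheet.step T N * ((N + 1 : ℕ) : ℝ) ≤ 2 * T := by
      rw [IceSheet.step, div_mul_eq_mul_div, div_le_iff₀ (by linarith)]
      push_cast
      nlinarith
    calc _ = IceSheet.step T N * ((N + 1 : ℕ) : ℝ) * (2 * M) := by ring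
      _ ≤ 2 * T * (2 * M) := by gcongr
      _ ≤ C := by rw [hC]; linarith
  · rw [IceSheet.sum_eLpNorm_div_sq hl N (f := fun n x =>
      IceSheet.oddPow ((IceSheet.alpha p - 2) / 2) (u (n + 1) x) -
        IceSheet.oddPow ((IceSheet.alpha p - 2) / 2) (u n x)) fun n hn =>
      (hβ (n + 1) (by omega)).1.sub (hβ n (by omega)).1]
    exact ENNReal.ofReal_le_ofReal (bB.trans (by rw [hC]; linarith))
  · exact (IceSheet.w1Norm_le hΩo (by linarith) hM.le (hW n hn).1 (bI n hn) (bG n hn)).trans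
      (ENNReal.ofReal_le_ofReal (by rw [hC]; linarith))
  · refine (IceSheet.dualNorm_le hΩo hb (by linarith) hμ₁ hμb hμ₂ hκ (hW (n + 1) (by omega))
      _ (hu.2.2 n hn) (bA n hn) (bI _ (by omega)) (bG _ (by omega))).trans
      (ENNReal.ofReal_le_ofReal ?_)
    have hκ' : 0 ≤ 1 + 1 / κ := by positivity
    refine mul_le_mul_of_nonneg_right ?_ hκ'
    rw [hC]; linarith
  · have hα1 : 0 < IceSheet.alpha p - 1 := by linarith
    refine (IceSheet.memLp_and_eLpNorm_le hb hp0 ?_ (hW n hn).1.1 hM.le (bI n hn)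
      (hodd (IceSheet.alpha p - 2) n hn) (hpow _ _ (by linarith) (by positivity) ?_ n hn)).2.trans
      hle
    · rw [le_div_iff₀ hα1]; linarith
    · field_simp; ring
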